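/- Let $\mathcal S,\mathcal A,\mathcal B$ be finite sets, $\mathcal B\neq\emptyset$, let $p_S$ be a probability distribution on $\mathcal S$ and $\Pi:\mathcal A\times\mathcal B\times\mathcal S\to\mathbb R$ the payoff to Player A of a zero-sum game. In the $n$-round repeated game the states $S_1,\dots,S_n$ are i.i.d. with law $p_S$. A helper observes $S^n=(S_1,\dots,S_n)$ and sends Player A a message drawn from a conditional distribution given $S^n$ on a set of at most $2^{nR}$ messages. In each round $i$ the players act simultaneously: Player A draws $A_i\in\mathcal A$ given the message and all past states and actions of both players, and Player B draws $B_i\in\mathcal B$ given all past states and actions of both players and, if Player B knows the state sequence, also given the whole of $S^n$. The protocol of the helper and Player A is fixed first and is known to Player B. An average payoff $P\in\mathbb R$ is achievable at rate $R\in\mathbb R$ if for every sufficiently large $n$ there is such a protocol under which $\mathbb E\big[\frac1n\sum_{i=1}^n\Pi(A_i,B_i,S_i)\big]\ge P$ for every strategy of Player B. For a finite set $\mathcal U$ and conditional distributions $p_{U|S}$, $p_{A|U}$, let $(S,U,A)\sim p_S\,p_{U|S}\,p_{A|U}$ (so $S-U-A$ is a Markov chain), let mutual informations be in bits, and put $$\underline\Pi_{p_{A|S}}=\min_{p_B}\sum_{a,b,s}p_S(s)p_{A|S}(a|s)p_B(b)\Pi(a,b,s),\qquad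 \underline\Pi^{(S)}_{p_{A|S}}=\min_{p_{B|S}}\sum_{a,b,s}p_S(s)p_{A|S}(a|s)p_{B|S}(b|s)\Pi(a,b,s),$$ $$\underline\Pi^{(U)}_{p_{A|U}}=\min_{p_{B|U}}\sum_{a,b,s,u}p_U(u)p_{S|U}(s|u)p_{A|U}(a|u)p_{B|U}(b|u)\Pi(a,b,s),$$ $$\underline\Pi^{(S,U)}_{p_{A|U}}=\min_{p_{B|S,U}}\sum_{a,b,s,u}p_U(u)p_{S|U}(s|u)p_{A|U}(a|u)p_{B|S,U}(b|s,u)\Pi(a,b,s).$$ (1) If Player B does not know the state sequence, then $P$ is achievable at rate $R$ whenever there are $\mathcal U$, $p_{U|S}$, $p_{A|U}$ with $$\underline\Pi_{p_{A|S}}>P,\qquad R>I(U;S),\qquad R>I(U;S,A)\,\frac{P-\underline\Pi^{(U)}_{p_{A|U}}}{\underline\Pi_{p_{A|S}}-\underline\Pi^{(U)}_{p_{A|U}}}.$$ (2) If Player B knows the state sequence, then $P$ is achievable at rate $R$ whenever there are $\mathcal U$, $p_{U|S}$, $p_{A|U}$ with $$\underline\Pi^{(S)}_{p_{A|S}}>P,\qquad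 R>I(U;S)+I(U;A|S)\left(\frac{P-\underline\Pi^{(S,U)}_{p_{A|U}}}{\underline\Pi^{(S)}_{p_{A|S}}-\underline\Pi^{(S,U)}_{p_{A|U}}}\right)^+,\qquad x^+=\max(x,0).$$ Here a fraction with denominator $0$ is read as $0$. -/

import Mathlib

open Filter

noncomputable section

namespace BayesGame

/-- Probability distributions on a finite set. -/
abbrev Distr (α : Type*) [Fintype α] : Type _ := stdSimplex ℝ α

/-- Conditional distributions (randomized maps): `W x y` is the probability of `y` given `x`. -/
abbrev Chan (α β : Type*) [Fintype β] : Type _ := α → Distr β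

section Information

variable {X Y Z : Type*} [Fintype X] [Fintype Y] [Fintype Z]

/-- Mutual information `I(X;Y)`, in bits, of a pair with joint probability mass function `q`. -/
def mutualInfo (q : X → Y → ℝ) : ℝ :=
  ∑ x, ∑ y, q x y * Real.logb 2 (q x y / ((∑ y', q x y') * (∑ x', q x' y)))

/-- Conditional mutual information `I(X;Y|Z)`, in bits, of a triple with joint probability mass
function `q`. -/
def condMutualInfo (q : X → Y → Z → ℝ) : ℝ :=
  ∑ x, ∑ y, ∑ z, q x y z *
    Real.logb 2 ((q x y z * (∑ x', ∑ y', q x' y' z)) / ((∑ y', q x y' z) * (∑ x', q x' y z)))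

end Information

variable {S A B U : Type*} [Fintype S] [Fintype A] [Fintype B] [Fintype U]

section OneShot

/-- The joint law of `(S, U, A)` when `S ∼ pS` and `p_{U,A|S} = p_{U|S} p_{A|U}`. -/
def jointSUA (pS : Distr S) (pUS : Chan S U) (pAU : Chan U A) (s : S) (u : U) (a : A) : ℝ :=
  pS s * pUS s u * pAU u a

/-- `I(U;S)`. -/
def infoUS (pS : Distr S) (pUS : Chan S U) (pAU : Chan U A) : ℝ :=
  mutualInfo fun (u : U) (s : S) => ∑ a, jointSUA pS pUS pAU s u a

/-- `I(U;S,A)`. -/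
def infoUSA (pS : Distr S) (pUS : Chan S U) (pAU : Chan U A) : ℝ :=
  mutualInfo fun (u : U) (sa : S × A) => jointSUA pS pUS pAU sa.1 u sa.2

/-- `I(U;A|S)`. -/
def infoUAgivenS (pS : Distr S) (pUS : Chan S U) (pAU : Chan U A) : ℝ :=
  condMutualInfo fun (u : U) (a : A) (s : S) => jointSUA pS pUS pAU s u a

/-- The least expected payoff when Player B knows neither `S` nor `U`. -/
def minPay (pay : A → B → S → ℝ) (pS : Distr S) (pUS : Chan S U) (pAU : Chan U A) : ℝ :=
  ⨅ pB : Distr B, ∑ a, ∑ b, ∑ s, (∑ u, jointSUA pS pUS pAU s u a) * pB b * pay a b s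

/-- The least expected payoff when Player B knows `S` but not `U`. -/
def minPayS (pay : A → B → S → ℝ) (pS : Distr S) (pUS : Chan S U) (pAU : Chan U A) : ℝ :=
  ⨅ pB : Chan S B, ∑ a, ∑ b, ∑ s, (∑ u, jointSUA pS pUS pAU s u a) * pB s b * pay a b s

/-- The least expected payoff when Player B knows `U` but not `S`
(`p_U p_{S|U} p_{A|U}` is the joint law of `(S, U, A)`). -/
def minPayU (pay : A → B → S → ℝ) (pS : Distr S) (pUS : Chan S U) (pAU : Chan U A) : ℝ :=
  ⨅ pB : Chan U B, ∑ a, ∑ b, ∑ s, ∑ u, jointSUA pS pUS pAU s u a * pB u b * pay a b s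

/-- The least expected payoff when Player B knows both `S` and `U`. -/
def minPaySU (pay : A → B → S → ℝ) (pS : Distr S) (pUS : Chan S U) (pAU : Chan U A) : ℝ :=
  ⨅ pB : Chan (S × U) B,
    ∑ a, ∑ b, ∑ s, ∑ u, jointSUA pS pUS pAU s u a * pB (s, u) b * pay a b s

end OneShot

section Repeated

/-- What is publicly known before round `i` of an `n`-round game: all earlier states and
actions. -/
abbrev History (S A B : Type*) {n : ℕ} (i : Fin n) : Type _ := Fin (i : ℕ) → S × A × B

/-- The history before round `i` of the play with states `s` and actions `a`, `b`. -/
def history {n : ℕ} (s : Fin n → S) (a : Fin n → A) (b : Fin n → B) (i : Fin n) :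
    History S A B i :=
  fun j => (s (Fin.castLE i.is_lt.le j), a (Fin.castLE i.is_lt.le j), b (Fin.castLE i.is_lt.le j))

/-- A protocol of block length `n` with `M` messages. The helper sees the whole state sequence
and draws a message; in round `i`, Player A draws an action given the message and the
history. -/
structure Protocol (S A B : Type*) [Fintype S] [Fintype A] [Fintype B] (n M : ℕ) where
  enc : Chan (Fin n → S) (Fin M)
  act : (i : Fin n) → Fin M → Chan (History S A B i) A

/-- A strategy of a Player B who does not know the state sequence: in round `i` an action is drawn
given the history (in particular he does not see the message or the current state). -/
abbrev BlindStrategy (S A B : Type*) [Fintype B] (n : ℕ) : Type _ :=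
  (i : Fin n) → Chan (History S A B i) B

/-- A strategy of a Player B who knows the whole state sequence from the start. -/
abbrev InformedStrategy (S A B : Type*) [Fintype B] (n : ℕ) : Type _ :=
  (i : Fin n) → (Fin n → S) → Chan (History S A B i) B

/-- A blind strategy, seen as an informed one that ignores the state sequence. -/
def BlindStrategy.toInformed {n : ℕ} (β : BlindStrategy S A B n) : InformedStrategy S A B n :=
  fun i _ => β i

/-- The probability that the states are `s`, the message is `m`, and the actions are `a`, `b`.
The states are i.i.d., and in every round the two players move simultaneously. -/
def playProb (pS : Distr S) {n M : ℕ} (σ : Protocol S A B n M) (β : InformedStrategy S A B n)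
    (s : Fin n → S) (m : Fin M) (a : Fin n → A) (b : Fin n → B) : ℝ :=
  (∏ i, pS (s i)) * σ.enc s m *
    ∏ i, σ.act i m (history s a b i) (a i) * β i s (history s a b i) (b i)

/-- The expected average payoff of Player A over the `n` rounds. -/
def avgPayoff (pay : A → B → S → ℝ) (pS : Distr S) {n M : ℕ} (σ : Protocol S A B n M)
    (β : InformedStrategy S A B n) : ℝ :=
  ∑ s : Fin n → S, ∑ m : Fin M, ∑ a : Fin n → A, ∑ b : Fin n → B,
    playProb pS σ β s m a b * ((∑ i, pay (a i) (b i) (s i)) / n)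

/-- Average payoff `P` is achievable at rate `R` when Player B does not know the state sequence:
for all large block lengths `n` some protocol with at most `2 ^ (n R)` messages guarantees
at least `P` against every strategy of Player B. -/
def AchievableBlind (pay : A → B → S → ℝ) (pS : Distr S) (P R : ℝ) : Prop :=
  ∀ᶠ n : ℕ in atTop, ∃ M : ℕ, (M : ℝ) ≤ 2 ^ ((n : ℝ) * R) ∧ ∃ σ : Protocol S A B n M,
    ∀ β : BlindStrategy S A B n, P ≤ avgPayoff pay pS σ β.toInformed

/-- Average payoff `P` is achievable at rate `R` when Player B knows the state sequence. -/
def AchievableInformed (pay : A → B → S → ℝ) (pS : Distr S) (P R : ℝ) : Prop :=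
  ∀ᶠ n : ℕ in atTop, ∃ M : ℕ, (M : ℝ) ≤ 2 ^ ((n : ℝ) * R) ∧ ∃ σ : Protocol S A B n M,
    ∀ β : InformedStrategy S A B n, P ≤ avgPayoff pay pS σ β

end Repeated

end BayesGame

end

/-!
The helper and Player A use a random codebook: `M ≈ 2 ^ (n R)` codewords with independent letters of
law `p_U`. The helper uses the likelihood encoder, that is, a message is drawn with probability
proportional to the likelihood of the states under its codeword sent through `p_{S|U}`, and Player A
sends the codeword letter by letter through `p_{A|U}`.

By soft covering (`softCovering`), a uniformly drawn codeword sent through a memoryless channel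
gives a nearly i.i.d. output if the rate exceeds the information of the channel. The proof cuts off large
likelihood ratios, bounds the rest by its variance, and controls the cut-off part by Chebyshev's
inequality. It is used twice.

* With the channel `p_{S|U}`, where `R > I(U;S)` is enough: the true play is close to the one in
  which a uniformly drawn codeword generates the states (`le_avgPayoff_codeProtocol`), because the
  likelihood encoder realizes the conditional law of the message given the states.
* With the channel `p_{S|U} p_{A|U}` in the first `k ≈ θ n` rounds. In the other rounds, whatever
  Player B cannot have seen before round `k` is redrawn independently of the letter: state and
  action if he is blind, the action given the state if he is informed. This needs a rate above
  `θ I(U;S,A)` or `I(U;S) + θ I(U;A|S)`, respectively. Before round `k`, states and actions then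
  look i.i.d., so the past is of no use to Player B (`IsCausal.le_sum`), and each round is worth
  `minPay` or `minPayS`.

After round `k` Player B may be assumed to know the codeword. Its letters have law `p_U`, so each
round is still worth `minPayU` or `minPaySU` on average over the codebooks. The average payoff thus
interpolates between the two values with weight `θ`, and the rate conditions say that some `θ` gives
more than `P` (`exists_fraction`). A codebook at least as good as the average exists. `Guarantees`
collects the facts in which the two kinds of opponent differ.
-/

open Filter

namespace BayesGame

/-! ### Sums over product distributions -/

section ProductSums

variable {ι Y : Type*} [Fintype ι] [DecidableEq ι] [Fintype Y]

theorem sum_sum_update (j : ι) (F : (ι → Y) → ℝ) :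
    ∑ y : ι → Y, ∑ v, F (Function.update y j v) = Fintype.card Y * ∑ y, F y := by
  let e : (ι → Y) × Y ≃ (ι → Y) × Y :=
    { toFun := fun p => (Function.update p.1 j p.2, p.1 j)
      invFun := fun p => (Function.update p.1 j p.2, p.1 j)
      left_inv := fun p => by simp
      right_inv := fun p => by simp }
  have h : ∑ p : (ι → Y) × Y, F (Function.update p.1 j p.2) = ∑ p : (ι → Y) × Y, F p.1 :=
    Fintype.sum_equiv e _ _ fun p => rfl
  rw [Fintype.sum_prod_type, Fintype.sum_prod_type] at h
  rw [h]
  simp [Finset.mul_sum]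

omit [Fintype Y] in
theorem prod_apply_update (ν : ι → Y → ℝ) (y : ι → Y) (j : ι) (v : Y) :
    ∏ i, ν i (Function.update y j v i) = ν j v * ∏ i ∈ Finset.univ.erase j, ν i (y i) := by
  rw [← Finset.mul_prod_erase _ _ (Finset.mem_univ j), Function.update_self]
  congr 1
  refine Finset.prod_congr rfl fun i hi => ?_
  rw [Function.update_of_ne (Finset.ne_of_mem_erase hi)]

theorem sum_prod_eq_one {ν : ι → Y → ℝ} (hν : ∀ i, ∑ v, ν i v = 1) :
    ∑ y : ι → Y, ∏ i, ν i (y i) = 1 := by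
  have h := Finset.prod_univ_sum (fun _ : ι => (Finset.univ : Finset Y)) ν
  rw [Fintype.piFinset_univ] at h
  rw [← h]
  simp [hν]


theorem card_ne_zero_of_sum {f : Y → ℝ} (hf : ∑ v, f v = 1) : (Fintype.card Y : ℝ) ≠ 0 := by
  have : Nonempty Y := by
    by_contra h
    rw [not_nonempty_iff] at h
    simp at hf
  positivity

/-- Under a product distribution one coordinate may be redrawn independently of everything else. -/
theorem sum_prod_resample {ν : ι → Y → ℝ} (hν : ∀ i, ∑ v, ν i v = 1) (j : ι)
    (F : (ι → Y) → ℝ) :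
    ∑ y : ι → Y, (∏ i, ν i (y i)) * F y =
      ∑ y : ι → Y, (∏ i, ν i (y i)) * ∑ v, ν j v * F (Function.update y j v) := by
  apply mul_left_cancel₀ (card_ne_zero_of_sum (hν j))
  rw [← sum_sum_update j, ← sum_sum_update j]
  refine Finset.sum_congr rfl fun y _ => ?_
  simp only [prod_apply_update, Function.update_idem]
  rw [← Finset.sum_mul, ← Finset.sum_mul, hν j, one_mul, Finset.mul_sum]
  exact Finset.sum_congr rfl fun v _ => by ring

theorem sum_prod_apply {ν : ι → Y → ℝ} (hν : ∀ i, ∑ v, ν i v = 1) (j : ι) (f : Y → ℝ) :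
    ∑ y : ι → Y, (∏ i, ν i (y i)) * f (y j) = ∑ v, ν j v * f v := by
  rw [sum_prod_resample hν j]
  simp only [Function.update_self]
  rw [← Finset.sum_mul, sum_prod_eq_one hν, one_mul]

/-- A function which ignores certain coordinates has the same mean under any two product
distributions which agree in the other coordinates. -/
theorem sum_prod_congr {ν ν' : ι → Y → ℝ} (hν : ∀ i, ∑ v, ν i v = 1)
    (hν' : ∀ i, ∑ v, ν' i v = 1) (F : (ι → Y) → ℝ)
    (h : ∀ i, ν i = ν' i ∨ ∀ y v, F (Function.update y i v) = F y) :
    ∑ y : ι → Y, (∏ i, ν i (y i)) * F y = ∑ y : ι → Y, (∏ i, ν' i (y i)) * F y := by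
  have key : ∀ T : Finset ι, ∑ y : ι → Y, (∏ i, ν i (y i)) * F y =
      ∑ y : ι → Y, (∏ i, (if i ∈ T then ν' i else ν i) (y i)) * F y := by
    intro T
    induction T using Finset.induction_on with
    | empty => simp
    | insert j T hj ih =>
      rw [ih]
      rcases h j with h | h
      · refine Finset.sum_congr rfl fun y _ => ?_
        congr 1
        refine Finset.prod_congr rfl fun i _ => ?_
        by_cases hi : i = j
        · subst hi; simp [hj, h]
        · simp [hi]
      · apply mul_left_cancel₀ (card_ne_zero_of_sum (hν j))
        rw [← sum_sum_update j, ← sum_sum_update j]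
        refine Finset.sum_congr rfl fun y _ => ?_
        simp only [h, prod_apply_update]
        rw [← Finset.sum_mul, ← Finset.sum_mul, ← Finset.sum_mul, ← Finset.sum_mul]
        simp only [hj, if_false, Finset.mem_insert_self, if_true, hν, hν']
        congr 2
        refine Finset.prod_congr rfl fun i hi => ?_
        simp [Finset.ne_of_mem_erase hi]
  simpa using key Finset.univ

/-- Variances of independent centred variables add up. -/
theorem sum_prod_sq {ν : ι → Y → ℝ} (hν : ∀ i, ∑ v, ν i v = 1) (Z : ι → Y → ℝ)
    (hZ : ∀ i, ∑ v, ν i v * Z i v = 0) :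
    ∑ y : ι → Y, (∏ i, ν i (y i)) * (∑ i, Z i (y i)) ^ 2 = ∑ i, ∑ v, ν i v * Z i v ^ 2 := by
  have h1 : ∀ y : ι → Y, (∏ i, ν i (y i)) * (∑ i, Z i (y i)) ^ 2 =
      ∑ j, ∑ l, (∏ i, ν i (y i)) * (Z j (y j) * Z l (y l)) := by
    intro y
    rw [sq, Finset.sum_mul_sum, Finset.mul_sum]
    exact Finset.sum_congr rfl fun j _ => by rw [Finset.mul_sum]
  simp only [h1]
  rw [Finset.sum_comm]
  refine Finset.sum_congr rfl fun j _ => ?_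
  rw [Finset.sum_comm, Finset.sum_eq_single j]
  · rw [← sum_prod_apply hν j fun v => Z j v ^ 2]
    exact Finset.sum_congr rfl fun y _ => by ring
  · intro l _ hl
    rw [sum_prod_resample hν j]
    apply Finset.sum_eq_zero
    intro y _
    simp only [Function.update_self, Function.update_of_ne hl, ← mul_assoc]
    rw [← Finset.sum_mul, hZ]
    simp
  · simp

end ProductSums

/-! ### Sequential play -/

section Sequential

variable {Y B : Type*} [Fintype Y] [Fintype B] {n : ℕ}

/-- The moves from time `t` on can be summed out, at the price of a factor `|B|` per move because
the sum still ranges over all of `Fin n → B`. -/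
theorem sum_prod_kernel_truncate {w : Fin n → (Fin n → B) → ℝ}
    (hw : ∀ j b b', (∀ l ≤ j, b l = b' l) → w j b = w j b')
    (hw1 : ∀ j b, ∑ v, w j (Function.update b j v) = 1) (G : (Fin n → B) → ℝ) (d t : ℕ)
    (hdt : t + d = n) (hG : ∀ b b' : Fin n → B, (∀ l : Fin n, (l : ℕ) < t → b l = b' l) →
      G b = G b') :
    (Fintype.card B : ℝ) ^ d * ∑ b, (∏ j, w j b) * G b =
      ∑ b, (∏ j ∈ Finset.univ.filter (fun j : Fin n => (j : ℕ) < t), w j b) * G b := by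
  induction d generalizing t with
  | zero =>
    rw [pow_zero, one_mul]
    refine Finset.sum_congr rfl fun b _ => ?_
    congr 2
    ext j
    simp only [Finset.mem_univ, Finset.mem_filter, true_and, true_iff]
    omega
  | succ d ih =>
    have ih' := ih (t + 1) (by omega) fun b b' h => hG b b' fun l hl => h l (by omega)
    rw [pow_succ', mul_assoc, ih']
    let j : Fin n := ⟨t, by omega⟩
    have hf : Finset.univ.filter (fun l : Fin n => (l : ℕ) < t + 1) =
        insert j (Finset.univ.filter (fun l : Fin n => (l : ℕ) < t)) := by
      ext l
      simp only [Finset.mem_filter, Finset.mem_univ, true_and, Finset.mem_insert, Fin.ext_iff, j]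
      omega
    rw [← sum_sum_update j]
    refine Finset.sum_congr rfl fun b _ => ?_
    have h1 : ∀ v, (∏ l ∈ Finset.univ.filter (fun l : Fin n => (l : ℕ) < t + 1),
        w l (Function.update b j v)) * G (Function.update b j v) =
        w j (Function.update b j v) *
          ((∏ l ∈ Finset.univ.filter (fun l : Fin n => (l : ℕ) < t), w l b) * G b) := by
      intro v
      rw [hf, Finset.prod_insert (by simp [j]), mul_assoc]
      congr 2
      · refine Finset.prod_congr rfl fun l hl => ?_
        rw [Finset.mem_filter] at hl
        refine hw _ _ _ fun l' hl' => Function.update_of_ne (fun h => ?_) _ _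
        rw [h, Fin.le_def] at hl'
        have := hl.2
        simp only [j] at hl'
        omega
      · refine hG _ _ fun l hl => Function.update_of_ne (fun h => ?_) _ _
        rw [h] at hl
        simp [j] at hl
    simp only [h1]
    rw [← Finset.sum_mul, hw1, one_mul]

variable [Nonempty B]

theorem sum_prod_kernel_eq_one {w : Fin n → (Fin n → B) → ℝ}
    (hw : ∀ j b b', (∀ l ≤ j, b l = b' l) → w j b = w j b')
    (hw1 : ∀ j b, ∑ v, w j (Function.update b j v) = 1) :
    ∑ b, ∏ j, w j b = 1 := by
  have h := sum_prod_kernel_truncate hw hw1 (fun _ => 1) n 0 (by simp) (fun _ _ _ => rfl)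
  have hc : (Fintype.card B : ℝ) ^ n ≠ 0 := by positivity
  apply mul_left_cancel₀ hc
  simpa using h

/-- The moves up to time `i` do not depend on how later moves are chosen. -/
theorem sum_prod_kernel_congr {w w' : Fin n → (Fin n → B) → ℝ}
    (hw : ∀ j b b', (∀ l ≤ j, b l = b' l) → w j b = w j b')
    (hw1 : ∀ j b, ∑ v, w j (Function.update b j v) = 1)
    (hw' : ∀ j b b', (∀ l ≤ j, b l = b' l) → w' j b = w' j b')
    (hw1' : ∀ j b, ∑ v, w' j (Function.update b j v) = 1) (i : Fin n)
    (hww : ∀ j ≤ i, ∀ b, w j b = w' j b) (f : B → ℝ) :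
    ∑ b, (∏ j, w j b) * f (b i) = ∑ b, (∏ j, w' j b) * f (b i) := by
  have hG : ∀ b b' : Fin n → B, (∀ l : Fin n, (l : ℕ) < (i : ℕ) + 1 → b l = b' l) →
      f (b i) = f (b' i) := fun b b' h => by rw [h i (by omega)]
  have hi := i.is_lt
  have h := sum_prod_kernel_truncate hw hw1 (fun b => f (b i)) (n - (i + 1)) (i + 1) (by omega) hG
  have h' := sum_prod_kernel_truncate hw' hw1' (fun b => f (b i)) (n - (i + 1)) (i + 1)
    (by omega) hG
  have hc : (Fintype.card B : ℝ) ^ (n - ((i : ℕ) + 1)) ≠ 0 := by positivity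
  apply mul_left_cancel₀ hc
  rw [h, h']
  refine Finset.sum_congr rfl fun b _ => ?_
  congr 1
  refine Finset.prod_congr rfl fun j hj => hww j ?_ b
  rw [Finset.mem_filter] at hj
  rw [Fin.le_def]
  omega

/-- A causal randomized reply to a sequence `y`: `w j y b` is the probability of the move `b j`,
given `y` and `b` before time `j`. It is encoded as a function of the full sequences which does not
depend on the irrelevant coordinates. -/
structure IsCausal (w : Fin n → (Fin n → Y) → (Fin n → B) → ℝ) : Prop where
  nonneg : ∀ j y b, 0 ≤ w j y b
  congr : ∀ j y y' b b', (∀ l < j, y l = y' l) → (∀ l ≤ j, b l = b' l) → w j y b = w j y' b'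
  sum_eq_one : ∀ j y b, ∑ v, w j y (Function.update b j v) = 1

variable {w : Fin n → (Fin n → Y) → (Fin n → B) → ℝ}

omit [Fintype Y] in
theorem IsCausal.sum_prod_eq_one (hw : IsCausal w) (y : Fin n → Y) :
    ∑ b, ∏ j, w j y b = 1 :=
  sum_prod_kernel_eq_one (fun j _ _ h => hw.congr j y y _ _ (fun _ _ => rfl) h)
    fun j b => hw.sum_eq_one j y b

omit [Fintype Y] in
theorem IsCausal.sum_congr (hw : IsCausal w) (i : Fin n) {y y' : Fin n → Y}
    (h : ∀ l < i, y l = y' l) (f : B → ℝ) :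
    ∑ b, (∏ j, w j y b) * f (b i) = ∑ b, (∏ j, w j y' b) * f (b i) :=
  sum_prod_kernel_congr (fun j _ _ h => hw.congr j y y _ _ (fun _ _ => rfl) h)
    (fun j b => hw.sum_eq_one j y b) (fun j _ _ h => hw.congr j y' y' _ _ (fun _ _ => rfl) h)
    (fun j b => hw.sum_eq_one j y' b) i
    (fun j hj b => hw.congr j y y' b b (fun l hl => h l (hl.trans_le hj)) fun _ _ => rfl) f

/-- Against an independent sequence, a causal reply does at time `i` no better than the best
constant move, because the past carries no information on `y i`. -/
theorem IsCausal.le_sum (hw : IsCausal w) {ν : Fin n → Y → ℝ} (hν0 : ∀ i v, 0 ≤ ν i v)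
    (hν : ∀ i, ∑ v, ν i v = 1) (i : Fin n) (φ : Y → B → ℝ) {c : ℝ}
    (hc : ∀ x, c ≤ ∑ v, ν i v * φ v x) :
    c ≤ ∑ y : Fin n → Y, (∏ j, ν j (y j)) * ∑ b, (∏ j, w j y b) * φ (y i) (b i) := by
  rw [sum_prod_resample hν i]
  have h : ∀ y : Fin n → Y, c ≤ ∑ v, ν i v * ∑ b, (∏ j, w j (Function.update y i v) b) *
      φ (Function.update y i v i) (b i) := by
    intro y
    have h1 : ∀ v, ∑ b, (∏ j, w j (Function.update y i v) b) *
        φ (Function.update y i v i) (b i) = ∑ b, (∏ j, w j y b) * φ v (b i) := by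
      intro v
      rw [Function.update_self]
      exact hw.sum_congr i (fun l hl => Function.update_of_ne hl.ne _ _) (φ v)
    simp only [h1, Finset.mul_sum]
    rw [Finset.sum_comm]
    calc c = ∑ b, (∏ j, w j y b) * c := by rw [← Finset.sum_mul, hw.sum_prod_eq_one, one_mul]
      _ ≤ _ := by
        refine Finset.sum_le_sum fun b _ => ?_
        calc (∏ j, w j y b) * c ≤ (∏ j, w j y b) * ∑ v, ν i v * φ v (b i) :=
              mul_le_mul_of_nonneg_left (hc _) (Finset.prod_nonneg fun j _ => hw.nonneg j y b)
          _ = _ := by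
            rw [Finset.mul_sum]
            exact Finset.sum_congr rfl fun v _ => by ring
  calc c = ∑ y : Fin n → Y, (∏ j, ν j (y j)) * c := by
        rw [← Finset.sum_mul, BayesGame.sum_prod_eq_one hν, one_mul]
    _ ≤ _ := Finset.sum_le_sum fun y _ =>
        mul_le_mul_of_nonneg_left (h y) (Finset.prod_nonneg fun j _ => hν0 j _)

end Sequential

/-! ### Soft covering -/

section SoftCovering

theorem sum_mul_abs_le_of_sum_mul_sq_le {α : Type*} [Fintype α] {μ : α → ℝ} (hμ : ∀ x, 0 ≤ μ x)
    (hμ1 : ∑ x, μ x = 1) (f : α → ℝ) {t : ℝ} (ht : 0 ≤ t) (h : ∑ x, μ x * f x ^ 2 ≤ t ^ 2) :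
    ∑ x, μ x * |f x| ≤ t := by
  refine (pow_le_pow_iff_left₀ (Finset.sum_nonneg fun x _ => mul_nonneg (hμ x) (abs_nonneg _)) ht
    two_ne_zero).mp ?_
  refine le_trans ?_ h
  have := Finset.sum_mul_sq_le_sq_mul_sq Finset.univ (fun x => √(μ x)) (fun x => √(μ x) * |f x|)
  simp only [mul_pow, Real.sq_sqrt (hμ _), hμ1, one_mul, sq_abs, ← mul_assoc,
    Real.mul_self_sqrt (hμ _)] at this
  exact this

variable {X Y : Type*} [Fintype X] [Fintype Y]

open Classical in
/-- One-shot soft covering: if `M` codewords are drawn independently from `r` and one of them,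
chosen uniformly, is sent through the channel `W`, then the output law is on average close to the
output law `p` for the input `r`. Outputs of likelihood ratio at most `τ` are handled through their
variance, and the others are discarded. -/
theorem softCovering_oneShot {r : X → ℝ} (hr : ∀ x, 0 ≤ r x) (hr1 : ∑ x, r x = 1)
    {W : X → Y → ℝ} (hW : ∀ x y, 0 ≤ W x y) {p : Y → ℝ} (hp : ∀ y, ∑ x, r x * W x y = p y)
    (hp1 : ∑ y, p y = 1) {M : ℕ} (hM : 0 < M) {τ : ℝ} (hτ : 0 ≤ τ) :
    ∑ c : Fin M → X, (∏ m, r (c m)) * ∑ y, |(∑ m, W (c m) y) / M - p y| ≤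
      √(τ / M) + 2 * ∑ x, ∑ y, r x * (if τ * p y < W x y then W x y else 0) := by
  have hM' : (0 : ℝ) < M := by exact_mod_cast hM
  have hp0 : ∀ y, 0 ≤ p y := fun y => by
    rw [← hp]; exact Finset.sum_nonneg fun x _ => mul_nonneg (hr x) (hW x y)
  have hμ0 : ∀ c : Fin M → X, 0 ≤ ∏ m, r (c m) := fun c => Finset.prod_nonneg fun m _ => hr _
  have hμ1 : ∑ c : Fin M → X, ∏ m, r (c m) = 1 := sum_prod_eq_one (fun _ => hr1)
  set W₁ : X → Y → ℝ := fun x y => if τ * p y < W x y then 0 else W x y with hW₁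
  set W₂ : X → Y → ℝ := fun x y => if τ * p y < W x y then W x y else 0 with hW₂
  have hW12 : ∀ x y, W x y = W₁ x y + W₂ x y := fun x y => by
    simp only [hW₁, hW₂]; split_ifs <;> simp
  have hW₁0 : ∀ x y, 0 ≤ W₁ x y := fun x y => by
    simp only [hW₁]; split_ifs; exacts [le_rfl, hW x y]
  have hW₂0 : ∀ x y, 0 ≤ W₂ x y := fun x y => by
    simp only [hW₂]; split_ifs; exacts [hW x y, le_rfl]
  have hW₁le : ∀ x y, W₁ x y ≤ τ * p y := fun x y => by
    simp only [hW₁]; split_ifs with h; exacts [mul_nonneg hτ (hp0 y), not_lt.mp h]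
  have hmain : ∀ y, ∑ c : Fin M → X, (∏ m, r (c m)) * |(∑ m, W (c m) y) / M - p y| ≤
      p y * √(τ / M) + 2 * ∑ x, r x * W₂ x y := by
    intro y
    set p₁ := ∑ x, r x * W₁ x y with hp₁
    set p₂ := ∑ x, r x * W₂ x y with hp₂
    have hpy : p y = p₁ + p₂ := by
      rw [← hp, hp₁, hp₂, ← Finset.sum_add_distrib]
      exact Finset.sum_congr rfl fun x _ => by rw [hW12, mul_add]
    have hp₂0 : 0 ≤ p₂ := Finset.sum_nonneg fun x _ => mul_nonneg (hr x) (hW₂0 x y)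
    have hp₁le : p₁ ≤ p y := by linarith
    have hsplit : ∀ c : Fin M → X, |(∑ m, W (c m) y) / M - p y| ≤
        |(∑ m, (W₁ (c m) y - p₁)) / M| + (∑ m, W₂ (c m) y) / M + p₂ := by
      intro c
      have h1 : (∑ m, W (c m) y) / M - p y =
          (∑ m, (W₁ (c m) y - p₁)) / M + ((∑ m, W₂ (c m) y) / M + (-p₂)) := by
        rw [hpy]
        simp only [hW12, Finset.sum_add_distrib, Finset.sum_sub_distrib, Finset.sum_const,
          Finset.card_univ, Fintype.card_fin, nsmul_eq_mul]
        field_simp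
        ring
      rw [h1]
      refine (abs_add_le _ _).trans ?_
      rw [add_assoc]
      gcongr
      refine (abs_add_le _ _).trans ?_
      rw [abs_neg, abs_of_nonneg hp₂0,
        abs_of_nonneg (div_nonneg (Finset.sum_nonneg fun m _ => hW₂0 _ _) hM'.le)]
    have hfirst : ∑ c : Fin M → X, (∏ m, r (c m)) * |(∑ m, (W₁ (c m) y - p₁)) / M| ≤
        p y * √(τ / M) := by
      apply sum_mul_abs_le_of_sum_mul_sq_le hμ0 hμ1 _ (mul_nonneg (hp0 y) (Real.sqrt_nonneg _))
      have hvar := sum_prod_sq (ι := Fin M) (ν := fun _ => r) (fun _ => hr1)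
        (fun _ x => W₁ x y - p₁) (fun _ => by
          simp only [mul_sub, Finset.sum_sub_distrib, ← Finset.sum_mul, hr1, one_mul]
          rw [← hp₁, sub_self])
      have h2 : ∑ c : Fin M → X, (∏ m, r (c m)) * ((∑ m, (W₁ (c m) y - p₁)) / M) ^ 2 =
          (∑ x, r x * (W₁ x y - p₁) ^ 2) / M := by
        simp only [div_pow, ← mul_div_assoc]
        rw [← Finset.sum_div, hvar]
        simp only [Finset.sum_const, Finset.card_univ, Fintype.card_fin, nsmul_eq_mul]
        field_simp
      rw [h2, mul_pow, Real.sq_sqrt (div_nonneg hτ hM'.le), ← mul_div_assoc]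
      apply div_le_div_of_nonneg_right _ hM'.le
      calc ∑ x, r x * (W₁ x y - p₁) ^ 2
          = ∑ x, r x * W₁ x y * W₁ x y - p₁ ^ 2 := by
            have : ∀ x, r x * (W₁ x y - p₁) ^ 2 =
                r x * W₁ x y * W₁ x y - 2 * p₁ * (r x * W₁ x y) + p₁ ^ 2 * r x := fun x => by ring
            simp only [this, Finset.sum_add_distrib, Finset.sum_sub_distrib, ← Finset.mul_sum, hr1]
            rw [← hp₁]
            ring
        _ ≤ ∑ x, r x * W₁ x y * W₁ x y := by nlinarith [sq_nonneg p₁]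
        _ ≤ ∑ x, r x * W₁ x y * (τ * p y) := by
            gcongr with x
            · exact mul_nonneg (hr x) (hW₁0 x y)
            · exact hW₁le x y
        _ = p₁ * (τ * p y) := by rw [← Finset.sum_mul]
        _ ≤ p y * (τ * p y) := mul_le_mul_of_nonneg_right hp₁le (mul_nonneg hτ (hp0 y))
        _ = p y ^ 2 * τ := by ring
    have hsecond : ∑ c : Fin M → X, (∏ m, r (c m)) * ((∑ m, W₂ (c m) y) / M) = p₂ := by
      simp only [← mul_div_assoc]
      rw [← Finset.sum_div]
      simp only [Finset.mul_sum]
      rw [Finset.sum_comm]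
      have : ∀ m : Fin M, ∑ c : Fin M → X, (∏ l, r (c l)) * W₂ (c m) y = p₂ := fun m =>
        sum_prod_apply (ν := fun _ => r) (fun _ => hr1) m fun x => W₂ x y
      simp only [this, Finset.sum_const, Finset.card_univ, Fintype.card_fin, nsmul_eq_mul]
      field_simp
    calc _ ≤ ∑ c : Fin M → X, (∏ m, r (c m)) * (|(∑ m, (W₁ (c m) y - p₁)) / M| +
            (∑ m, W₂ (c m) y) / M + p₂) :=
          Finset.sum_le_sum fun c _ => mul_le_mul_of_nonneg_left (hsplit c) (hμ0 c)
      _ = ∑ c : Fin M → X, (∏ m, r (c m)) * |(∑ m, (W₁ (c m) y - p₁)) / M| + p₂ + p₂ := by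
          simp only [mul_add, Finset.sum_add_distrib]
          rw [hsecond, ← Finset.sum_mul, hμ1, one_mul]
      _ ≤ _ := by linarith
  calc _ = ∑ y, ∑ c : Fin M → X, (∏ m, r (c m)) * |(∑ m, W (c m) y) / M - p y| := by
        simp only [Finset.mul_sum]
        rw [Finset.sum_comm]
    _ ≤ ∑ y, (p y * √(τ / M) + 2 * ∑ x, r x * W₂ x y) := Finset.sum_le_sum fun y _ => hmain y
    _ = _ := by
        rw [Finset.sum_add_distrib, ← Finset.sum_mul, hp1, one_mul, ← Finset.mul_sum,
          Finset.sum_comm]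

end SoftCovering

section SoftCoveringBlock

variable {U Y κ : Type*} [Fintype U] [Fintype Y]

/-- The information, in bits, between input and output of the channel `V` with input law `r` and
output law `p`. -/
noncomputable def chanInfo (r : U → ℝ) (p : Y → ℝ) (V : U → Y → ℝ) : ℝ :=
  ∑ u, ∑ y, r u * V u y * Real.logb 2 (V u y / p y)

/-- The second moment of the information density whose mean is `chanInfo`. -/
noncomputable def chanInfoSq (r : U → ℝ) (p : Y → ℝ) (V : U → Y → ℝ) : ℝ :=
  ∑ u, ∑ y, r u * V u y * Real.logb 2 (V u y / p y) ^ 2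

open Classical in
/-- By Chebyshev's inequality, the likelihood ratio of a block is unlikely to exceed `2 ^ (n t)` if
`t` is larger than the average information. -/
theorem sum_atypical_le {r : U → ℝ} (hr : ∀ u, 0 ≤ r u) (hr1 : ∑ u, r u = 1)
    {V : κ → U → Y → ℝ} (hV : ∀ k u y, 0 ≤ V k u y) (hV1 : ∀ k u, ∑ y, V k u y = 1)
    {p : Y → ℝ} (hp : ∀ k y, ∑ u, r u * V k u y = p y) {C : ℝ}
    (hC : ∀ k, chanInfoSq r p (V k) ≤ C) {n : ℕ} (hn : 0 < n) (σ : Fin n → κ) {t δ : ℝ}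
    (hδ : 0 < δ) (hI : ∑ i, chanInfo r p (V (σ i)) ≤ n * (t - δ)) :
    ∑ x : Fin n → U, ∑ y : Fin n → Y, (∏ i, r (x i)) *
      (if (2 : ℝ) ^ (n * t) * ∏ i, p (y i) < ∏ i, V (σ i) (x i) (y i)
        then ∏ i, V (σ i) (x i) (y i) else 0) ≤ C / (n * δ ^ 2) := by
  have hn' : (0 : ℝ) < n := by exact_mod_cast hn
  let ν : Fin n → U × Y → ℝ := fun i q => r q.1 * V (σ i) q.1 q.2
  let ξ : Fin n → U × Y → ℝ := fun i q => Real.logb 2 (V (σ i) q.1 q.2 / p q.2)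
  let Z : Fin n → U × Y → ℝ := fun i q => ξ i q - chanInfo r p (V (σ i))
  have hν0 : ∀ i q, 0 ≤ ν i q := fun i q => mul_nonneg (hr _) (hV _ _ _)
  have hν1 : ∀ i, ∑ q, ν i q = 1 := fun i => by
    rw [Fintype.sum_prod_type]
    simp only [ν, ← Finset.mul_sum, hV1, mul_one, hr1]
  have hξ : ∀ i, ∑ q, ν i q * ξ i q = chanInfo r p (V (σ i)) := fun i => by
    rw [Fintype.sum_prod_type]; rfl
  have hξ2 : ∀ i, ∑ q, ν i q * ξ i q ^ 2 = chanInfoSq r p (V (σ i)) := fun i => by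
    rw [Fintype.sum_prod_type]; rfl
  have hZ : ∀ i, ∑ q, ν i q * Z i q = 0 := fun i => by
    simp only [Z, mul_sub, Finset.sum_sub_distrib, ← Finset.sum_mul, hν1, hξ]
    ring
  have hZ2 : ∀ i, ∑ q, ν i q * Z i q ^ 2 ≤ C := fun i => by
    refine le_trans ?_ (hC (σ i))
    have : ∀ q, ν i q * Z i q ^ 2 = ν i q * ξ i q ^ 2 -
        2 * chanInfo r p (V (σ i)) * (ν i q * ξ i q) + chanInfo r p (V (σ i)) ^ 2 * ν i q :=
      fun q => by simp only [Z]; ring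
    simp only [this, Finset.sum_add_distrib, Finset.sum_sub_distrib, ← Finset.mul_sum, hν1, hξ, hξ2]
    nlinarith [sq_nonneg (chanInfo r p (V (σ i)))]
  have hprod : ∀ z : Fin n → U × Y, ∏ i, ν i (z i) =
      (∏ i, r (z i).1) * ∏ i, V (σ i) (z i).1 (z i).2 := fun z => Finset.prod_mul_distrib
  -- On the atypical event the centred information density exceeds `n δ`.
  have hpt : ∀ z : Fin n → U × Y, (∏ i, r (z i).1) *
      (if (2 : ℝ) ^ (n * t) * ∏ i, p (z i).2 < ∏ i, V (σ i) (z i).1 (z i).2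
        then ∏ i, V (σ i) (z i).1 (z i).2 else 0) ≤
      (∏ i, ν i (z i)) * (∑ i, Z i (z i)) ^ 2 / (n * δ) ^ 2 := by
    intro z
    have hν : 0 ≤ ∏ i, ν i (z i) := Finset.prod_nonneg fun i _ => hν0 i _
    split_ifs with h
    · rw [← hprod]
      rcases hν.eq_or_lt with h0 | h0
      · rw [← h0]; simp
      have hne : ∀ i, 0 < r (z i).1 ∧ 0 < V (σ i) (z i).1 (z i).2 := by
        intro i
        have := Finset.prod_ne_zero_iff.mp h0.ne' i (Finset.mem_univ i)
        have h1 := left_ne_zero_of_mul this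
        have h2 := right_ne_zero_of_mul this
        exact ⟨lt_of_le_of_ne (hr _) h1.symm, lt_of_le_of_ne (hV _ _ _) h2.symm⟩
      have hppos : ∀ i, 0 < p (z i).2 := by
        intro i
        rw [← hp (σ i)]
        exact lt_of_lt_of_le (mul_pos (hne i).1 (hne i).2)
          (Finset.single_le_sum (f := fun u => r u * V (σ i) u (z i).2)
            (fun u _ => mul_nonneg (hr u) (hV _ _ _)) (Finset.mem_univ (z i).1))
      have hsum : n * t < ∑ i, ξ i (z i) := by
        have h3 : ∑ i, ξ i (z i) = Real.logb 2 (∏ i, V (σ i) (z i).1 (z i).2 / p (z i).2) := by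
          rw [Real.logb_prod]
          intro i _
          exact (div_pos (hne i).2 (hppos i)).ne'
        rw [h3, Finset.prod_div_distrib, Real.lt_logb_iff_rpow_lt one_lt_two]
        · rwa [lt_div_iff₀ (Finset.prod_pos fun i _ => hppos i)]
        · exact div_pos (Finset.prod_pos fun i _ => (hne i).2)
            (Finset.prod_pos fun i _ => hppos i)
      have hge : n * δ ≤ ∑ i, Z i (z i) := by
        simp only [Z, Finset.sum_sub_distrib]
        linarith
      rw [mul_div_assoc]
      apply le_mul_of_one_le_right hν
      rw [one_le_div (by positivity)]
      exact pow_le_pow_left₀ (by positivity) hge 2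
    · rw [mul_zero]
      positivity
  calc _ = ∑ z : Fin n → U × Y, (∏ i, r (z i).1) *
      (if (2 : ℝ) ^ (n * t) * ∏ i, p (z i).2 < ∏ i, V (σ i) (z i).1 (z i).2
        then ∏ i, V (σ i) (z i).1 (z i).2 else 0) := by
        rw [← Fintype.sum_prod_type']
        exact (Fintype.sum_equiv (Equiv.arrowProdEquivProdArrow (Fin n) (fun _ => U) (fun _ => Y))
          _ _ fun z => rfl).symm
    _ ≤ ∑ z : Fin n → U × Y, (∏ i, ν i (z i)) * (∑ i, Z i (z i)) ^ 2 / (n * δ) ^ 2 :=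
        Finset.sum_le_sum fun z _ => hpt z
    _ = (∑ i, ∑ q, ν i q * Z i q ^ 2) / (n * δ) ^ 2 := by
        rw [← Finset.sum_div, sum_prod_sq hν1 Z hZ]
    _ ≤ (∑ _i : Fin n, C) / (n * δ) ^ 2 := by
        gcongr with i
        exact hZ2 i
    _ = _ := by
        simp only [Finset.sum_const, Finset.card_univ, Fintype.card_fin, nsmul_eq_mul]
        field_simp

/-- Soft covering for blocks: a random codebook of rate `R` whose words have independent letters of
law `r` makes the output of a memoryless channel look independent of law `p`, as soon as `R`
exceeds the average information by `2 δ`. The channel may vary with the position. -/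
theorem softCovering {r : U → ℝ} (hr : ∀ u, 0 ≤ r u) (hr1 : ∑ u, r u = 1)
    {V : κ → U → Y → ℝ} (hV : ∀ k u y, 0 ≤ V k u y) (hV1 : ∀ k u, ∑ y, V k u y = 1)
    {p : Y → ℝ} (hp : ∀ k y, ∑ u, r u * V k u y = p y) {C : ℝ}
    (hC : ∀ k, chanInfoSq r p (V k) ≤ C) {n : ℕ} (hn : 0 < n) (σ : Fin n → κ) {R δ : ℝ}
    (hδ : 0 < δ) (hI : ∑ i, chanInfo r p (V (σ i)) ≤ n * (R - 2 * δ)) {M : ℕ} (hM : 0 < M)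
    (hMR : (2 : ℝ) ^ (n * R) ≤ 2 * M) :
    ∑ c : Fin M → Fin n → U, (∏ m, ∏ i, r (c m i)) *
      ∑ y : Fin n → Y, |(∑ m, ∏ i, V (σ i) (c m i) (y i)) / M - ∏ i, p (y i)| ≤
      √(2 * (2 : ℝ) ^ (-δ * n)) + 2 * (C / (n * δ ^ 2)) := by
  have hM' : (0 : ℝ) < M := by exact_mod_cast hM
  have hout : ∀ y : Fin n → Y, ∑ x : Fin n → U, (∏ i, r (x i)) * ∏ i, V (σ i) (x i) (y i) =
      ∏ i, p (y i) := fun y => by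
    have h := Finset.prod_univ_sum (fun _ : Fin n => (Finset.univ : Finset U))
      fun i u => r u * V (σ i) u (y i)
    simp only [Fintype.piFinset_univ, hp] at h
    simp only [← Finset.prod_mul_distrib, h]
  by_cases hne : Nonempty κ
  swap
  · -- Without channels there are no positions.
    exact absurd ⟨σ ⟨0, hn⟩⟩ hne
  obtain ⟨k⟩ := hne
  have hp1 : ∑ y, p y = 1 := by
    simp only [← hp k]
    rw [Finset.sum_comm]
    simp only [← Finset.mul_sum, hV1, mul_one, hr1]
  have h := softCovering_oneShot (M := M) (r := fun x : Fin n → U => ∏ i, r (x i))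
    (fun x => Finset.prod_nonneg fun i _ => hr _) (sum_prod_eq_one fun _ => hr1)
    (W := fun x y => ∏ i, V (σ i) (x i) (y i))
    (fun x y => Finset.prod_nonneg fun i _ => hV _ _ _) hout (sum_prod_eq_one fun _ => hp1) hM
    (τ := (2 : ℝ) ^ (n * (R - δ))) (by positivity)
  refine h.trans (add_le_add ?_ ?_)
  · apply Real.sqrt_le_sqrt
    rw [div_le_iff₀ hM']
    calc (2 : ℝ) ^ (n * (R - δ)) = 2 ^ (-δ * n) * 2 ^ (n * R) := by
          rw [← Real.rpow_add two_pos]; congr 1; ring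
      _ ≤ 2 ^ (-δ * n) * (2 * M) := by gcongr
      _ = _ := by ring
  · apply mul_le_mul_of_nonneg_left _ zero_le_two
    exact sum_atypical_le hr hr1 hV hV1 hp hC hn σ hδ (hI.trans_eq (by ring))

end SoftCoveringBlock

/-! ### Information quantities of the test channel -/

section Info

variable {U Y : Type*} [Fintype U] [Fintype Y]

/-- The pointwise inequality behind the nonnegativity of relative entropy. -/
theorem sub_div_log_two_le_mul_logb {x y : ℝ} (hx : 0 ≤ x) (hy : 0 ≤ y) (hxy : y = 0 → x = 0) :
    (x - y) / Real.log 2 ≤ x * Real.logb 2 (x / y) := by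
  have h2 : 0 < Real.log 2 := Real.log_pos one_lt_two
  rw [Real.logb, ← mul_div_assoc]
  apply div_le_div_of_nonneg_right _ h2.le
  rcases hx.eq_or_lt with rfl | hx
  · simp [hy]
  have hy' : 0 < y := lt_of_le_of_ne hy fun h => hx.ne' (hxy h.symm)
  have h := Real.log_le_sub_one_of_pos (div_pos hy' hx)
  have hinv : Real.log (x / y) = -Real.log (y / x) := by rw [← Real.log_inv, inv_div]
  rw [hinv]
  have : x * Real.log (y / x) ≤ x * (y / x - 1) := mul_le_mul_of_nonneg_left h hx.le
  have h3 : x * (y / x - 1) = y - x := by field_simp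
  linarith

theorem chanInfo_nonneg {r : U → ℝ} (hr : ∀ u, 0 ≤ r u) (hr1 : ∑ u, r u = 1) {V : U → Y → ℝ}
    (hV : ∀ u y, 0 ≤ V u y) (hV1 : ∀ u, ∑ y, V u y = 1) {p : Y → ℝ}
    (hp : ∀ y, ∑ u, r u * V u y = p y) : 0 ≤ chanInfo r p V := by
  have hp1 : ∑ y, p y = 1 := by
    simp only [← hp]
    rw [Finset.sum_comm]
    simp only [← Finset.mul_sum, hV1, mul_one, hr1]
  have hp0 : ∀ y, 0 ≤ p y := fun y => by
    rw [← hp]; exact Finset.sum_nonneg fun u _ => mul_nonneg (hr u) (hV u y)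
  calc (0 : ℝ) = ∑ u, ∑ y, r u * ((V u y - p y) / Real.log 2) := by
        simp [← Finset.mul_sum, ← Finset.sum_div, Finset.sum_sub_distrib, hV1, hp1]
    _ ≤ chanInfo r p V := by
        refine Finset.sum_le_sum fun u _ => Finset.sum_le_sum fun y _ => ?_
        rcases (hr u).eq_or_lt with h | h
        · simp [← h]
        rw [mul_assoc]
        refine mul_le_mul_of_nonneg_left (sub_div_log_two_le_mul_logb (hV u y) (hp0 y) fun h0 => ?_)
          h.le
        rw [← hp] at h0
        have := (Finset.sum_eq_zero_iff_of_nonneg fun u _ => mul_nonneg (hr u) (hV u y)).mp h0 u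
          (Finset.mem_univ u)
        exact (mul_eq_zero.mp this).resolve_left h.ne'

theorem mutualInfo_eq_chanInfo {r : U → ℝ} {V : U → Y → ℝ} {p : Y → ℝ} {q : U → Y → ℝ}
    (hq : ∀ u y, q u y = r u * V u y) (hV1 : ∀ u, ∑ y, V u y = 1)
    (hp : ∀ y, ∑ u, r u * V u y = p y) : mutualInfo q = chanInfo r p V := by
  refine Finset.sum_congr rfl fun u _ => Finset.sum_congr rfl fun y _ => ?_
  simp only [hq, ← Finset.mul_sum, hV1, hp, mul_one]
  by_cases h : r u = 0
  · simp [h]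
  · rw [mul_div_mul_left _ _ h]

theorem chanInfo_const (r : U → ℝ) (p : Y → ℝ) : chanInfo r p (fun _ => p) = 0 := by
  refine Finset.sum_eq_zero fun u _ => Finset.sum_eq_zero fun y _ => ?_
  by_cases h : p y = 0
  · simp [h]
  · simp [div_self h]

end Info

section TestChannel

variable {S A B U : Type*} [Fintype S] [Fintype A] [Fintype B] [Fintype U]
variable (pS : Distr S) (pUS : Chan S U) (pAU : Chan U A)

/-- The marginal law `p_U`. -/
noncomputable def lawU (u : U) : ℝ := ∑ s, pS s * pUS s u

open Classical in
/-- The conditional law `p_{S|U}`. For letters `u` of probability zero it is set to `p_S`, so that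
it is a probability distribution for every `u`. -/
noncomputable def backChan (u : U) (s : S) : ℝ := 
  if lawU pS pUS u = 0 then pS s else pS s * pUS s u / lawU pS pUS u

/-- The conditional law `p_{A|S}`. -/
noncomputable def actLaw (pUS : Chan S U) (pAU : Chan U A) (s : S) (a : A) : ℝ :=
  ∑ u, pUS s u * pAU u a

/-- The joint law of state and action. -/
noncomputable def lawSA (y : S × A) : ℝ := pS y.1 * actLaw pUS pAU y.1 y.2

/-- The channel from `U` to `(S, A)`. -/
noncomputable def chanSA (u : U) (y : S × A) : ℝ := backChan pS pUS u y.1 * pAU u y.2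

/-- The channel from `U` to `(S, A)` in which, given `S`, the action is redrawn independently of
`U`. -/
noncomputable def chanSARedrawn (u : U) (y : S × A) : ℝ :=
  backChan pS pUS u y.1 * actLaw pUS pAU y.1 y.2

theorem lawU_nonneg (u : U) : 0 ≤ lawU pS pUS u :=
  Finset.sum_nonneg fun s _ => mul_nonneg (stdSimplex.zero_le pS s) (stdSimplex.zero_le _ u)

theorem sum_lawU : ∑ u, lawU pS pUS u = 1 := by
  simp only [lawU]
  rw [Finset.sum_comm]
  simp [← Finset.mul_sum]

theorem lawU_mul_backChan (u : U) (s : S) :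
    lawU pS pUS u * backChan pS pUS u s = pS s * pUS s u := by
  unfold backChan
  split_ifs with h
  · have := (Finset.sum_eq_zero_iff_of_nonneg fun s _ =>
      mul_nonneg (stdSimplex.zero_le pS s) (stdSimplex.zero_le (pUS s) u)).mp h s
        (Finset.mem_univ s)
    rw [h, this, zero_mul]
  · field_simp

theorem backChan_nonneg (u : U) (s : S) : 0 ≤ backChan pS pUS u s := by
  unfold backChan
  split_ifs
  · exact stdSimplex.zero_le pS s
  · exact div_nonneg (mul_nonneg (stdSimplex.zero_le pS s) (stdSimplex.zero_le _ u))
      (lawU_nonneg pS pUS u)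

theorem sum_backChan (u : U) : ∑ s, backChan pS pUS u s = 1 := by
  unfold backChan
  split_ifs with h
  · simp
  · rw [← Finset.sum_div]
    exact div_self h

theorem sum_lawU_mul_backChan (s : S) : ∑ u, lawU pS pUS u * backChan pS pUS u s = pS s := by
  simp only [lawU_mul_backChan, ← Finset.mul_sum, stdSimplex.sum_eq_one, mul_one]

omit [Fintype S] in
theorem actLaw_nonneg (s : S) (a : A) : 0 ≤ actLaw pUS pAU s a :=
  Finset.sum_nonneg fun u _ => mul_nonneg (stdSimplex.zero_le _ u) (stdSimplex.zero_le _ a)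

omit [Fintype S] in
theorem sum_actLaw (s : S) : ∑ a, actLaw pUS pAU s a = 1 := by
  simp only [actLaw]
  rw [Finset.sum_comm]
  simp [← Finset.mul_sum]

theorem lawSA_nonneg (y : S × A) : 0 ≤ lawSA pS pUS pAU y :=
  mul_nonneg (stdSimplex.zero_le pS _) (actLaw_nonneg _ _ _ _)

theorem sum_lawSA : ∑ y, lawSA pS pUS pAU y = 1 := by
  rw [Fintype.sum_prod_type]
  simp only [lawSA, ← Finset.mul_sum, sum_actLaw, mul_one, stdSimplex.sum_eq_one]

theorem chanSA_nonneg (u : U) (y : S × A) : 0 ≤ chanSA pS pUS pAU u y :=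
  mul_nonneg (backChan_nonneg _ _ _ _) (stdSimplex.zero_le _ _)

theorem sum_chanSA (u : U) : ∑ y, chanSA pS pUS pAU u y = 1 := by
  rw [Fintype.sum_prod_type]
  simp only [chanSA, ← Finset.mul_sum, stdSimplex.sum_eq_one, mul_one, sum_backChan]

theorem chanSARedrawn_nonneg (u : U) (y : S × A) : 0 ≤ chanSARedrawn pS pUS pAU u y :=
  mul_nonneg (backChan_nonneg _ _ _ _) (actLaw_nonneg _ _ _ _)

theorem sum_chanSARedrawn (u : U) : ∑ y, chanSARedrawn pS pUS pAU u y = 1 := by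
  rw [Fintype.sum_prod_type]
  simp only [chanSARedrawn, ← Finset.mul_sum, sum_actLaw, mul_one, sum_backChan]

theorem lawU_mul_chanSA (u : U) (y : S × A) :
    lawU pS pUS u * chanSA pS pUS pAU u y = jointSUA pS pUS pAU y.1 u y.2 := by
  rw [chanSA, ← mul_assoc, lawU_mul_backChan, jointSUA]

theorem sum_jointSUA (s : S) (a : A) :
    ∑ u, jointSUA pS pUS pAU s u a = lawSA pS pUS pAU (s, a) := by
  simp only [jointSUA, lawSA, actLaw, Finset.mul_sum, mul_assoc]

theorem sum_lawU_mul_chanSA (y : S × A) :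
    ∑ u, lawU pS pUS u * chanSA pS pUS pAU u y = lawSA pS pUS pAU y := by
  simp only [lawU_mul_chanSA, sum_jointSUA]

theorem sum_lawU_mul_chanSARedrawn (y : S × A) :
    ∑ u, lawU pS pUS u * chanSARedrawn pS pUS pAU u y = lawSA pS pUS pAU y := by
  simp only [chanSARedrawn, ← mul_assoc]
  rw [← Finset.sum_mul, sum_lawU_mul_backChan, lawSA]

theorem infoUS_eq : infoUS pS pUS pAU = chanInfo (lawU pS pUS) pS (backChan pS pUS) := by
  refine mutualInfo_eq_chanInfo (fun u s => ?_) (sum_backChan pS pUS) (sum_lawU_mul_backChan pS pUS)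
  simp only [jointSUA, ← Finset.mul_sum, stdSimplex.sum_eq_one, mul_one, lawU_mul_backChan]

theorem infoUS_nonneg : 0 ≤ infoUS pS pUS pAU := by
  rw [infoUS_eq]
  exact chanInfo_nonneg (lawU_nonneg _ _) (sum_lawU _ _) (backChan_nonneg _ _) (sum_backChan _ _)
    (sum_lawU_mul_backChan _ _)

theorem infoUSA_eq : infoUSA pS pUS pAU =
    chanInfo (lawU pS pUS) (lawSA pS pUS pAU) (chanSA pS pUS pAU) :=
  mutualInfo_eq_chanInfo (fun u y => (lawU_mul_chanSA pS pUS pAU u y).symm)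
    (sum_chanSA pS pUS pAU) (sum_lawU_mul_chanSA pS pUS pAU)

theorem infoUSA_nonneg : 0 ≤ infoUSA pS pUS pAU := by
  rw [infoUSA_eq]
  exact chanInfo_nonneg (lawU_nonneg _ _) (sum_lawU _ _) (chanSA_nonneg _ _ _) (sum_chanSA _ _ _)
    (sum_lawU_mul_chanSA _ _ _)

theorem chanInfo_chanSARedrawn :
    chanInfo (lawU pS pUS) (lawSA pS pUS pAU) (chanSARedrawn pS pUS pAU) = infoUS pS pUS pAU := by
  rw [infoUS_eq]
  refine Finset.sum_congr rfl fun u _ => ?_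
  rw [Fintype.sum_prod_type]
  refine Finset.sum_congr rfl fun s _ => ?_
  calc _ = ∑ a, actLaw pUS pAU s a * (lawU pS pUS u * backChan pS pUS u s *
        Real.logb 2 (backChan pS pUS u s / pS s)) := by
        refine Finset.sum_congr rfl fun a _ => ?_
        simp only [chanSARedrawn, lawSA]
        by_cases h : actLaw pUS pAU s a = 0
        · simp [h]
        · rw [mul_div_mul_right _ _ h]
          ring
    _ = _ := by rw [← Finset.sum_mul, sum_actLaw, one_mul]

theorem infoUAgivenS_eq_sum : infoUAgivenS pS pUS pAU = ∑ u, ∑ a, ∑ s, jointSUA pS pUS pAU s u a *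
    Real.logb 2
      (jointSUA pS pUS pAU s u a * pS s / (pS s * pUS s u * lawSA pS pUS pAU (s, a))) := by
  have h2 : ∀ s u, ∑ a, jointSUA pS pUS pAU s u a = pS s * pUS s u := fun s u => by
    simp only [jointSUA, ← Finset.mul_sum, stdSimplex.sum_eq_one, mul_one]
  simp only [infoUAgivenS, condMutualInfo, h2, sum_jointSUA, ← Finset.mul_sum,
    stdSimplex.sum_eq_one, mul_one]

theorem jointSUA_nonneg (s : S) (u : U) (a : A) : 0 ≤ jointSUA pS pUS pAU s u a :=
  mul_nonneg (mul_nonneg (stdSimplex.zero_le _ _) (stdSimplex.zero_le _ _)) (stdSimplex.zero_le _ _)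

theorem lawSA_pos {s : S} {u : U} {a : A} (h : jointSUA pS pUS pAU s u a ≠ 0) :
    0 < lawSA pS pUS pAU (s, a) := by
  rw [← sum_jointSUA]
  exact lt_of_lt_of_le (lt_of_le_of_ne (jointSUA_nonneg pS pUS pAU s u a) h.symm)
    (Finset.single_le_sum (f := fun u => jointSUA pS pUS pAU s u a)
      (fun u _ => jointSUA_nonneg pS pUS pAU s u a) (Finset.mem_univ u))

theorem infoUAgivenS_nonneg : 0 ≤ infoUAgivenS pS pUS pAU := by
  rw [infoUAgivenS_eq_sum]
  calc (0 : ℝ) = ∑ u, ∑ a, ∑ s,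
        (jointSUA pS pUS pAU s u a - pUS s u * lawSA pS pUS pAU (s, a)) / Real.log 2 := by
        have h1 : ∀ a s, ∑ u, (jointSUA pS pUS pAU s u a - pUS s u * lawSA pS pUS pAU (s, a)) /
            Real.log 2 = 0 := fun a s => by
          rw [← Finset.sum_div, Finset.sum_sub_distrib, sum_jointSUA, ← Finset.sum_mul,
            stdSimplex.sum_eq_one]
          simp
        rw [Finset.sum_comm, eq_comm]
        refine Finset.sum_eq_zero fun a _ => ?_
        rw [Finset.sum_comm]
        exact Finset.sum_eq_zero fun s _ => h1 a s
    _ ≤ _ := by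
        refine Finset.sum_le_sum fun u _ => Finset.sum_le_sum fun a _ =>
          Finset.sum_le_sum fun s _ => ?_
        have hy : 0 ≤ pUS s u * lawSA pS pUS pAU (s, a) :=
          mul_nonneg (stdSimplex.zero_le _ _) (lawSA_nonneg _ _ _ _)
        by_cases h : jointSUA pS pUS pAU s u a = 0
        · rw [h]
          simp only [zero_sub, zero_mul]
          exact div_nonpos_of_nonpos_of_nonneg (by linarith) (Real.log_pos one_lt_two).le
        have hS : pS s ≠ 0 := fun h0 => h (by simp [jointSUA, h0])
        have hU : pUS s u ≠ 0 := fun h0 => h (by simp [jointSUA, h0])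
        have e : jointSUA pS pUS pAU s u a * pS s / (pS s * pUS s u * lawSA pS pUS pAU (s, a)) =
            jointSUA pS pUS pAU s u a / (pUS s u * lawSA pS pUS pAU (s, a)) := by
          rw [mul_comm _ (pS s), mul_assoc, mul_div_mul_left _ _ hS]
        rw [e]
        refine sub_div_log_two_le_mul_logb (jointSUA_nonneg _ _ _ _ _ _) hy fun h0 => ?_
        exact absurd h0 (mul_ne_zero hU (lawSA_pos pS pUS pAU h).ne')

/-- The chain rule `I(U;S,A) = I(U;S) + I(U;A|S)`. -/
theorem infoUSA_eq_add : infoUSA pS pUS pAU = infoUS pS pUS pAU + infoUAgivenS pS pUS pAU := by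
  rw [infoUSA_eq, infoUS_eq, infoUAgivenS_eq_sum]
  unfold chanInfo
  rw [← Finset.sum_add_distrib]
  refine Finset.sum_congr rfl fun u _ => ?_
  rw [Fintype.sum_prod_type, Finset.sum_comm (s := (Finset.univ : Finset A)),
    ← Finset.sum_add_distrib]
  refine Finset.sum_congr rfl fun s _ => ?_
  have h1 : lawU pS pUS u * backChan pS pUS u s * Real.logb 2 (backChan pS pUS u s / pS s) =
      ∑ a, jointSUA pS pUS pAU s u a * Real.logb 2 (backChan pS pUS u s / pS s) := by
    rw [← Finset.sum_mul, lawU_mul_backChan]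
    simp only [jointSUA, ← Finset.mul_sum, stdSimplex.sum_eq_one, mul_one]
  rw [h1, ← Finset.sum_add_distrib]
  refine Finset.sum_congr rfl fun a _ => ?_
  rw [lawU_mul_chanSA, ← mul_add]
  by_cases h : jointSUA pS pUS pAU s u a = 0
  · simp [h]
  congr 1
  have hS : pS s ≠ 0 := fun h0 => h (by simp [jointSUA, h0])
  have hU : pUS s u ≠ 0 := fun h0 => h (by simp [jointSUA, h0])
  have hA : pAU u a ≠ 0 := fun h0 => h (by simp [jointSUA, h0])
  have hSA := (lawSA_pos pS pUS pAU h).ne'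
  have hb : backChan pS pUS u s ≠ 0 := fun h0 => by
    have := lawU_mul_backChan pS pUS u s
    rw [h0, mul_zero] at this
    exact mul_ne_zero hS hU this.symm
  rw [← Real.logb_mul (div_ne_zero hb hS)
    (div_ne_zero (mul_ne_zero h hS) (mul_ne_zero (mul_ne_zero hS hU) hSA))]
  congr 1
  simp only [chanSA, jointSUA]
  field_simp

/-! ### The one-shot values -/

theorem bddBelow_range_chan {X : Type*} {f : Chan X B → ℝ} (hf : Continuous f) :
    BddBelow (Set.range f) :=
  (isCompact_range hf).bddBelow

theorem continuous_chan_apply {X : Type*} (x : X) (b : B) : Continuous fun p : Chan X B => p x b :=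
  ((continuous_apply b).comp continuous_subtype_val).comp (continuous_apply x)

variable (pay : A → B → S → ℝ)

/-- The least payoff given `U = u` if only `U` is known. -/
noncomputable def valU (u : U) : ℝ := ⨅ b : B, ∑ y, chanSA pS pUS pAU u y * pay y.2 b y.1

/-- The least payoff given `S = s` if only `S` is known. -/
noncomputable def valS (s : S) : ℝ := ⨅ b : B, ∑ a, actLaw pUS pAU s a * pay a b s

/-- The least payoff given `S = s` and `U = u` if both are known. -/
noncomputable def valSU (u : U) (s : S) : ℝ := ⨅ b : B, ∑ a, pAU u a * pay a b s

theorem valU_le (u : U) (b : B) :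
    valU pS pUS pAU pay u ≤ ∑ y, chanSA pS pUS pAU u y * pay y.2 b y.1 :=
  ciInf_le (Set.finite_range _).bddBelow b

omit [Fintype S] in
theorem valS_le (s : S) (b : B) : valS pUS pAU pay s ≤ ∑ a, actLaw pUS pAU s a * pay a b s :=
  ciInf_le (Set.finite_range _).bddBelow b

omit [Fintype S] [Fintype U] in
theorem valSU_le (u : U) (s : S) (b : B) : valSU pAU pay u s ≤ ∑ a, pAU u a * pay a b s :=
  ciInf_le (Set.finite_range _).bddBelow b

omit [Fintype S] [Fintype A] [Fintype U] in
theorem sum_mul_vertex_mul [DecidableEq B] (x : ℝ) (b₀ : B) (f : B → ℝ) :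
    ∑ b, x * (stdSimplex.vertex b₀ : Distr B) b * f b = x * f b₀ := by
  rw [Finset.sum_eq_single b₀]
  · simp
  · intro b' _ h
    simp [h]
  · simp

open Classical in
theorem minPay_le (b : B) : minPay pay pS pUS pAU ≤ ∑ y, lawSA pS pUS pAU y * pay y.2 b y.1 := by
  have hbdd : BddBelow (Set.range fun pB : Distr B =>
      ∑ a, ∑ b, ∑ s, (∑ u, jointSUA pS pUS pAU s u a) * pB b * pay a b s) := by
    refine (isCompact_range ?_).bddBelow
    refine continuous_finsetSum _ fun a _ => continuous_finsetSum _ fun b _ =>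
      continuous_finsetSum _ fun s _ => (continuous_const.mul ?_).mul continuous_const
    exact (continuous_apply b).comp continuous_subtype_val
  refine (ciInf_le hbdd (stdSimplex.vertex b)).trans_eq ?_
  rw [Fintype.sum_prod_type_right]
  refine Finset.sum_congr rfl fun a _ => ?_
  rw [Finset.sum_comm]
  refine Finset.sum_congr rfl fun s _ => ?_
  rw [sum_mul_vertex_mul _ b fun b => pay a b s, sum_jointSUA]

variable [Nonempty B]

open Classical in
theorem minPayS_le : minPayS pay pS pUS pAU ≤ ∑ s, pS s * valS pUS pAU pay s := by
  have hbdd : BddBelow (Set.range fun pB : Chan S B =>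
      ∑ a, ∑ b, ∑ s, (∑ u, jointSUA pS pUS pAU s u a) * pB s b * pay a b s) :=
    bddBelow_range_chan <| continuous_finsetSum _ fun a _ => continuous_finsetSum _ fun b _ =>
      continuous_finsetSum _ fun s _ =>
        (continuous_const.mul (continuous_chan_apply _ _)).mul continuous_const
  have hex : ∀ s, ∃ b : B, ∑ a, actLaw pUS pAU s a * pay a b s = valS pUS pAU pay s :=
    fun s => exists_eq_ciInf_of_finite
  choose g hg using hex
  refine (ciInf_le hbdd fun s => stdSimplex.vertex (g s)).trans_eq ?_
  simp only [← hg, Finset.mul_sum]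
  conv_rhs => rw [Finset.sum_comm]
  refine Finset.sum_congr rfl fun a _ => ?_
  rw [Finset.sum_comm]
  refine Finset.sum_congr rfl fun s _ => ?_
  rw [sum_mul_vertex_mul _ (g s) fun b => pay a b s, sum_jointSUA, lawSA, mul_assoc]

open Classical in
theorem minPayU_le : minPayU pay pS pUS pAU ≤ ∑ u, lawU pS pUS u * valU pS pUS pAU pay u := by
  have hbdd : BddBelow (Set.range fun pB : Chan U B =>
      ∑ a, ∑ b, ∑ s, ∑ u, jointSUA pS pUS pAU s u a * pB u b * pay a b s) :=
    bddBelow_range_chan <| continuous_finsetSum _ fun a _ => continuous_finsetSum _ fun b _ =>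
      continuous_finsetSum _ fun s _ => continuous_finsetSum _ fun u _ =>
        (continuous_const.mul (continuous_chan_apply _ _)).mul continuous_const
  have hex : ∀ u, ∃ b : B, ∑ y, chanSA pS pUS pAU u y * pay y.2 b y.1 = valU pS pUS pAU pay u :=
    fun u => exists_eq_ciInf_of_finite
  choose g hg using hex
  refine (ciInf_le hbdd fun u => stdSimplex.vertex (g u)).trans_eq ?_
  simp only [← hg, Finset.mul_sum, ← mul_assoc, lawU_mul_chanSA]
  conv_rhs => rw [Finset.sum_comm, Fintype.sum_prod_type_right]
  refine Finset.sum_congr rfl fun a _ => ?_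
  rw [Finset.sum_comm]
  refine Finset.sum_congr rfl fun s _ => ?_
  rw [Finset.sum_comm]
  exact Finset.sum_congr rfl fun u _ => sum_mul_vertex_mul _ (g u) fun b => pay a b s

open Classical in
theorem minPaySU_le :
    minPaySU pay pS pUS pAU ≤
      ∑ u, lawU pS pUS u * ∑ s, backChan pS pUS u s * valSU pAU pay u s := by
  have hbdd : BddBelow (Set.range fun pB : Chan (S × U) B =>
      ∑ a, ∑ b, ∑ s, ∑ u, jointSUA pS pUS pAU s u a * pB (s, u) b * pay a b s) :=
    bddBelow_range_chan <| continuous_finsetSum _ fun a _ => continuous_finsetSum _ fun b _ =>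
      continuous_finsetSum _ fun s _ => continuous_finsetSum _ fun u _ =>
        (continuous_const.mul (continuous_chan_apply _ _)).mul continuous_const
  have hex : ∀ q : S × U, ∃ b : B, ∑ a, pAU q.2 a * pay a b q.1 = valSU pAU pay q.2 q.1 :=
    fun q => exists_eq_ciInf_of_finite
  choose g hg using hex
  refine (ciInf_le hbdd fun q => stdSimplex.vertex (g q)).trans_eq ?_
  have hr : ∀ u s, lawU pS pUS u * (backChan pS pUS u s * valSU pAU pay u s) =
      ∑ a, jointSUA pS pUS pAU s u a * pay a (g (s, u)) s := fun u s => by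
    rw [← hg (s, u), ← mul_assoc, lawU_mul_backChan, Finset.mul_sum]
    exact Finset.sum_congr rfl fun a _ => by rw [jointSUA, mul_assoc (pS s * pUS s u)]
  simp only [Finset.mul_sum, hr]
  conv_rhs =>
    rw [Finset.sum_comm]
    enter [2, s]
    rw [Finset.sum_comm]
  conv_rhs => rw [Finset.sum_comm]
  refine Finset.sum_congr rfl fun a _ => ?_
  rw [Finset.sum_comm]
  refine Finset.sum_congr rfl fun s _ => ?_
  rw [Finset.sum_comm]
  exact Finset.sum_congr rfl fun u _ => sum_mul_vertex_mul _ (g (s, u)) fun b => pay a b s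

end TestChannel

/-! ### The protocol built from a codebook -/

section Protocols

variable {S A B U : Type*} [Fintype S] [Fintype A] [Fintype B] [Fintype U] {n M : ℕ}

omit [Fintype S] [Fintype A] [Fintype B] in
theorem history_congr {s s' : Fin n → S} {a a' : Fin n → A} {b b' : Fin n → B} {i : Fin n}
    (hs : ∀ l < i, s l = s' l) (ha : ∀ l < i, a l = a' l) (hb : ∀ l < i, b l = b' l) :
    history s a b i = history s' a' b' i := by
  funext j
  have hj : Fin.castLE i.is_lt.le j < i := j.is_lt
  simp only [history, hs _ hj, ha _ hj, hb _ hj]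

omit [Fintype S] [Fintype A] in
theorem isCausal_blind (β : BlindStrategy S A B n) :
    IsCausal fun j (y : Fin n → S × A) b =>
      β j (history (fun l => (y l).1) (fun l => (y l).2) b j) (b j) where
  nonneg _ _ _ := stdSimplex.zero_le _ _
  congr j y y' b b' hy hb := by
    rw [hb j le_rfl, history_congr (fun l hl => congrArg Prod.fst (hy l hl))
      (fun l hl => congrArg Prod.snd (hy l hl)) fun l hl => hb l hl.le]
  sum_eq_one j y b := by
    have h : ∀ v, history (fun l => (y l).1) (fun l => (y l).2) (Function.update b j v) j =
        history (fun l => (y l).1) (fun l => (y l).2) b j := fun v =>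
      history_congr (fun _ _ => rfl) (fun _ _ => rfl)
        fun l hl => Function.update_of_ne hl.ne _ _
    simp [h]

omit [Fintype S] [Fintype A] in
theorem isCausal_informed (β : InformedStrategy S A B n) (s : Fin n → S) :
    IsCausal fun j (a : Fin n → A) b => β j s (history s a b j) (b j) where
  nonneg _ _ _ := stdSimplex.zero_le _ _
  congr j a a' b b' ha hb := by
    rw [hb j le_rfl, history_congr (fun _ _ => rfl) ha fun l hl => hb l hl.le]
  sum_eq_one j a b := by
    have h : ∀ v, history s a (Function.update b j v) j = history s a b j := fun v =>
      history_congr (fun _ _ => rfl) (fun _ _ => rfl)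
        fun l hl => Function.update_of_ne hl.ne _ _
    simp [h]

/-- The expected payoff in round `i` against the strategy `β`, given that the states and the
actions of Player A over all rounds are `y`. -/
noncomputable def condPay (pay : A → B → S → ℝ) (β : InformedStrategy S A B n) (i : Fin n)
    (y : Fin n → S × A) : ℝ :=
  ∑ b : Fin n → B, (∏ j, β j (fun l => (y l).1)
    (history (fun l => (y l).1) (fun l => (y l).2) b j) (b j)) * pay (y i).2 (b i) (y i).1

theorem abs_sum_mul_le {α : Type*} [Fintype α] {μ f : α → ℝ} (hμ : ∀ x, 0 ≤ μ x)
    (hμ1 : ∑ x, μ x = 1) {K : ℝ} (hf : ∀ x, |f x| ≤ K) : |∑ x, μ x * f x| ≤ K := by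
  calc |∑ x, μ x * f x| ≤ ∑ x, |μ x * f x| := Finset.abs_sum_le_sum_abs _ _
    _ ≤ ∑ x, μ x * K := Finset.sum_le_sum fun x _ => by
        rw [abs_mul, abs_of_nonneg (hμ x)]
        exact mul_le_mul_of_nonneg_left (hf x) (hμ x)
    _ = K := by rw [← Finset.sum_mul, hμ1, one_mul]

omit [Fintype S] [Fintype A] in
theorem abs_condPay_le [Nonempty B] {pay : A → B → S → ℝ} {K : ℝ} (hK : ∀ a b s, |pay a b s| ≤ K)
    (β : InformedStrategy S A B n) (i : Fin n) (y : Fin n → S × A) : |condPay pay β i y| ≤ K :=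
  abs_sum_mul_le (fun _ => Finset.prod_nonneg fun _ _ => stdSimplex.zero_le _ _)
    ((isCausal_informed β fun l => (y l).1).sum_prod_eq_one fun l => (y l).2) fun _ => hK _ _ _

variable (pS : Distr S) (pUS : Chan S U) (pAU : Chan U A)

/-- The likelihood of the states `s` if the codeword of message `m` passes through `p_{S|U}`. -/
noncomputable def likelihood (c : Fin M → Fin n → U) (s : Fin n → S) (m : Fin M) : ℝ :=
  ∏ i, backChan pS pUS (c m i) (s i)

theorem likelihood_nonneg (c : Fin M → Fin n → U) (s : Fin n → S) (m : Fin M) :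
    0 ≤ likelihood pS pUS c s m :=
  Finset.prod_nonneg fun _ _ => backChan_nonneg _ _ _ _

open Classical in
/-- The likelihood encoder: messages are drawn with probability proportional to their likelihood.
State sequences which are impossible for every message are sent to message `0`. -/
noncomputable def likelihoodEncoder (hM : 0 < M) (c : Fin M → Fin n → U) :
    Chan (Fin n → S) (Fin M) := fun s =>
  if h : ∑ m, likelihood pS pUS c s m = 0 then stdSimplex.vertex ⟨0, hM⟩
  else ⟨fun m => likelihood pS pUS c s m / ∑ m', likelihood pS pUS c s m',
    fun m => div_nonneg (likelihood_nonneg _ _ _ _ _)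
      (Finset.sum_nonneg fun _ _ => likelihood_nonneg _ _ _ _ _),
    by rw [← Finset.sum_div, div_self h]⟩

theorem sum_likelihood_mul_encoder (hM : 0 < M) (c : Fin M → Fin n → U) (s : Fin n → S)
    (m : Fin M) : (∑ m', likelihood pS pUS c s m') * likelihoodEncoder pS pUS hM c s m =
      likelihood pS pUS c s m := by
  unfold likelihoodEncoder
  split_ifs with h
  · rw [h, zero_mul]
    exact ((Finset.sum_eq_zero_iff_of_nonneg fun m _ => likelihood_nonneg pS pUS c s m).mp h m
      (Finset.mem_univ m)).symm
  · exact mul_div_cancel₀ _ h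

/-- The protocol with the likelihood encoder in which Player A passes the codeword of the message
letter by letter through `p_{A|U}`. -/
noncomputable def codeProtocol (B : Type*) [Fintype B] (hM : 0 < M) (c : Fin M → Fin n → U) :
    Protocol S A B n M where
  enc := likelihoodEncoder pS pUS hM c
  act i m _ := pAU (c m i)

/-- The average payoff, given the states `s` and the message `m`. -/
noncomputable def payGiven (pay : A → B → S → ℝ) (c : Fin M → Fin n → U)
    (β : InformedStrategy S A B n) (s : Fin n → S) (m : Fin M) : ℝ :=
  (∑ i, ∑ a : Fin n → A, (∏ j, pAU (c m j) (a j)) * condPay pay β i fun l => (s l, a l)) / n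

theorem avgPayoff_codeProtocol (pay : A → B → S → ℝ) (hM : 0 < M) (c : Fin M → Fin n → U)
    (β : InformedStrategy S A B n) :
    avgPayoff pay pS (codeProtocol pS pUS pAU B hM c) β =
      ∑ s : Fin n → S, ∑ m, (∏ i, pS (s i)) * likelihoodEncoder pS pUS hM c s m *
        payGiven pAU pay c β s m := by
  refine Finset.sum_congr rfl fun s _ => Finset.sum_congr rfl fun m _ => ?_
  conv_rhs => rw [payGiven, Finset.sum_comm, Finset.sum_div, Finset.mul_sum]
  refine Finset.sum_congr rfl fun a _ => ?_
  simp only [condPay, Finset.mul_sum, Finset.sum_div]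
  rw [Finset.sum_comm]
  refine Finset.sum_congr rfl fun i _ => Finset.sum_congr rfl fun b _ => ?_
  simp only [playProb, codeProtocol, Finset.prod_mul_distrib]
  ring

omit [Fintype U] in
theorem abs_payGiven_le [Nonempty B] {pay : A → B → S → ℝ} {K : ℝ}
    (hK : ∀ a b s, |pay a b s| ≤ K) (hn : 0 < n) (c : Fin M → Fin n → U)
    (β : InformedStrategy S A B n) (s : Fin n → S) (m : Fin M) :
    |payGiven pAU pay c β s m| ≤ K := by
  have hn' : (0 : ℝ) < n := by exact_mod_cast hn
  rw [payGiven, abs_div, abs_of_pos hn', div_le_iff₀ hn']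
  calc _ ≤ ∑ i : Fin n, |∑ a : Fin n → A, (∏ j, pAU (c m j) (a j)) *
        condPay pay β i fun l => (s l, a l)| := Finset.abs_sum_le_sum_abs _ _
    _ ≤ ∑ _i : Fin n, K := Finset.sum_le_sum fun i _ =>
        abs_sum_mul_le (fun a => Finset.prod_nonneg fun _ _ => stdSimplex.zero_le _ _)
          (sum_prod_eq_one fun j => stdSimplex.sum_eq_one _) fun a => abs_condPay_le hK β i _
    _ = K * n := by simp [mul_comm]

/-- Sums over sequences of pairs, as iterated sums. -/
theorem sum_prod_pair (f : Fin n → S → ℝ) (g : Fin n → S → A → ℝ) (F : (Fin n → S × A) → ℝ) :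
    ∑ y : Fin n → S × A, (∏ j, f j (y j).1 * g j (y j).1 (y j).2) * F y =
      ∑ s : Fin n → S, (∏ j, f j (s j)) *
        ∑ a : Fin n → A, (∏ j, g j (s j) (a j)) * F fun l => (s l, a l) := by
  simp only [Finset.mul_sum]
  rw [← Fintype.sum_prod_type']
  refine Fintype.sum_equiv (Equiv.arrowProdEquivProdArrow (Fin n) (fun _ => S) (fun _ => A))
    _ _ fun y => ?_
  simp only [Finset.prod_mul_distrib, mul_assoc]
  rfl

/-- If the states were generated from a uniformly drawn codeword, the average payoff would split
into contributions of the messages and the rounds. -/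
theorem sum_likelihood_mul_payGiven (pay : A → B → S → ℝ) (c : Fin M → Fin n → U)
    (β : InformedStrategy S A B n) :
    ∑ s : Fin n → S, ∑ m, likelihood pS pUS c s m / M * payGiven pAU pay c β s m =
      (∑ i, (∑ m, ∑ y : Fin n → S × A, (∏ j, chanSA pS pUS pAU (c m j) (y j)) *
        condPay pay β i y) / M) / n := by
  have h : ∀ m i, ∑ y : Fin n → S × A, (∏ j, chanSA pS pUS pAU (c m j) (y j)) *
      condPay pay β i y = ∑ s : Fin n → S, likelihood pS pUS c s m *
        ∑ a : Fin n → A, (∏ j, pAU (c m j) (a j)) * condPay pay β i fun l => (s l, a l) :=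
    fun m i => sum_prod_pair (fun j => backChan pS pUS (c m j)) (fun j _ => pAU (c m j)) _
  simp only [h, payGiven]
  rw [Finset.sum_comm, ← Finset.sum_div, Finset.sum_comm (s := (Finset.univ : Finset (Fin n)))]
  rw [Finset.sum_div, Finset.sum_div]
  refine Finset.sum_congr rfl fun m _ => ?_
  rw [Finset.sum_comm, Finset.sum_div, Finset.sum_div]
  refine Finset.sum_congr rfl fun s _ => ?_
  rw [← Finset.mul_sum]
  ring

/-- Replacing the true law of states and message by the one in which a uniformly drawn codeword
generates the states costs the total variation distance of the two laws of the states, because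
the likelihood encoder realizes the conditional law of the message given the states. -/
theorem le_avgPayoff_codeProtocol [Nonempty B] {pay : A → B → S → ℝ} {K : ℝ}
    (hK : ∀ a b s, |pay a b s| ≤ K) (hn : 0 < n) (hM : 0 < M) (c : Fin M → Fin n → U)
    (β : InformedStrategy S A B n) :
    (∑ i, (∑ m, ∑ y : Fin n → S × A, (∏ j, chanSA pS pUS pAU (c m j) (y j)) *
        condPay pay β i y) / M) / n -
      K * ∑ s : Fin n → S, |(∑ m, ∏ i, backChan pS pUS (c m i) (s i)) / M - ∏ i, pS (s i)| ≤
    avgPayoff pay pS (codeProtocol pS pUS pAU B hM c) β := by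
  have hM' : (M : ℝ) ≠ 0 := by exact_mod_cast hM.ne'
  rw [← sum_likelihood_mul_payGiven, avgPayoff_codeProtocol, sub_le_iff_le_add,
    ← sub_le_iff_le_add', ← Finset.sum_sub_distrib, Finset.mul_sum]
  refine Finset.sum_le_sum fun s _ => ?_
  have h1 : ∑ m, likelihood pS pUS c s m / M * payGiven pAU pay c β s m -
      ∑ m, (∏ i, pS (s i)) * likelihoodEncoder pS pUS hM c s m * payGiven pAU pay c β s m =
      ((∑ m, likelihood pS pUS c s m) / M - ∏ i, pS (s i)) *
        ∑ m, likelihoodEncoder pS pUS hM c s m * payGiven pAU pay c β s m := by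
    rw [← Finset.sum_sub_distrib, Finset.mul_sum]
    refine Finset.sum_congr rfl fun m _ => ?_
    rw [← sum_likelihood_mul_encoder pS pUS hM c s m]
    ring
  rw [h1]
  refine (le_abs_self _).trans ?_
  rw [abs_mul, mul_comm]
  exact mul_le_mul_of_nonneg_right (abs_sum_mul_le (fun m => stdSimplex.zero_le _ _)
    (stdSimplex.sum_eq_one _) fun m => abs_payGiven_le pAU hK hn c β s m) (abs_nonneg _)

/-! ### Guarantees for a random codebook -/

/-- What the achievability proof needs to know of a class `𝒞` of strategies of Player B. The payoffs
before round `k` do not change if, in the rounds from `k` on, the channel from codeword letters to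
states and actions is replaced by `V`. If states and actions are i.i.d. then `a` is guaranteed in
each round. If they are generated by a given codeword then the value `h` of its letter is guaranteed
in each round. -/
structure Guarantees (pay : A → B → S → ℝ) (𝒞 : ∀ n, Set (InformedStrategy S A B n))
    (V : U → S × A → ℝ) (a : ℝ) (h : U → ℝ) : Prop where
  redraw : ∀ n, ∀ β ∈ 𝒞 n, ∀ (k : ℕ) (i : Fin n), (i : ℕ) < k → ∀ u : Fin n → U,
    ∑ y : Fin n → S × A, (∏ j, chanSA pS pUS pAU (u j) (y j)) * condPay pay β i y =
      ∑ y : Fin n → S × A,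
        (∏ j : Fin n, (if (j : ℕ) < k then chanSA pS pUS pAU else V) (u j) (y j)) *
          condPay pay β i y
  iid : ∀ n, ∀ β ∈ 𝒞 n, ∀ i : Fin n,
    a ≤ ∑ y : Fin n → S × A, (∏ j, lawSA pS pUS pAU (y j)) * condPay pay β i y
  codeword : ∀ n, ∀ β ∈ 𝒞 n, ∀ (i : Fin n) (u : Fin n → U),
    h (u i) ≤ ∑ y : Fin n → S × A, (∏ j, chanSA pS pUS pAU (u j) (y j)) * condPay pay β i y

variable {pS pUS pAU} {pay : A → B → S → ℝ} {𝒞 : ∀ n, Set (InformedStrategy S A B n)}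
  {V : U → S × A → ℝ} {a : ℝ} {h : U → ℝ}

/-- The payoff which a given codebook guarantees, in terms of two total variation distances. -/
theorem Guarantees.le_avgPayoff [Nonempty B] (H : Guarantees pS pUS pAU pay 𝒞 V a h) {K : ℝ}
    (hK : ∀ a b s, |pay a b s| ≤ K) (hn : 0 < n) (hM : 0 < M) (k : ℕ) (c : Fin M → Fin n → U)
    (β : InformedStrategy S A B n) (hβ : β ∈ 𝒞 n) :
    (∑ i : Fin n, if (i : ℕ) < k then
        a - K * ∑ y : Fin n → S × A, |(∑ m, ∏ j : Fin n,
          (if (j : ℕ) < k then chanSA pS pUS pAU else V) (c m j) (y j)) / M -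
            ∏ j, lawSA pS pUS pAU (y j)|
        else (∑ m, h (c m i)) / M) / n -
      K * ∑ s : Fin n → S, |(∑ m, ∏ i, backChan pS pUS (c m i) (s i)) / M - ∏ i, pS (s i)| ≤
    avgPayoff pay pS (codeProtocol pS pUS pAU B hM c) β := by
  refine le_trans (sub_le_sub_right ?_ _) (le_avgPayoff_codeProtocol pS pUS pAU hK hn hM c β)
  gcongr with i
  split_ifs with hi
  · have h1 : (∑ m, ∑ y : Fin n → S × A, (∏ j, chanSA pS pUS pAU (c m j) (y j)) *
        condPay pay β i y) / M = ∑ y : Fin n → S × A, (∑ m, ∏ j : Fin n,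
          (if (j : ℕ) < k then chanSA pS pUS pAU else V) (c m j) (y j)) / M *
            condPay pay β i y := by
      simp only [H.redraw n β hβ k i hi]
      rw [Finset.sum_comm, Finset.sum_div]
      refine Finset.sum_congr rfl fun y _ => ?_
      rw [← Finset.sum_mul]
      ring
    rw [h1]
    have h2 := H.iid n β hβ i
    rw [sub_le_iff_le_add, Finset.mul_sum, ← Finset.sum_add_distrib]
    refine h2.trans (Finset.sum_le_sum fun y _ => ?_)
    rw [← sub_le_iff_le_add', ← sub_mul]
    refine (le_abs_self _).trans ?_
    rw [abs_mul, abs_sub_comm, mul_comm]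
    exact mul_le_mul_of_nonneg_right (abs_condPay_le hK β i y) (abs_nonneg _)
  · gcongr with m
    exact H.codeword n β hβ i (c m)

theorem exists_sum_mul_le {α : Type*} [Fintype α] {μ : α → ℝ} (hμ : ∀ x, 0 ≤ μ x)
    (hμ1 : ∑ x, μ x = 1) (f : α → ℝ) : ∃ x, ∑ y, μ y * f y ≤ f x := by
  have : Nonempty α := by
    by_contra h
    rw [not_nonempty_iff] at h
    simp at hμ1
  obtain ⟨x, hx⟩ := Finite.exists_max f
  refine ⟨x, ?_⟩
  calc ∑ y, μ y * f y ≤ ∑ y, μ y * f x :=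
        Finset.sum_le_sum fun y _ => mul_le_mul_of_nonneg_left (hx y) (hμ y)
    _ = f x := by rw [← Finset.sum_mul, hμ1, one_mul]

theorem sum_ite_lt_const {n k : ℕ} (hk : k ≤ n) (x y : ℝ) :
    (∑ i : Fin n, if (i : ℕ) < k then x else y) = k * x + (n - k) * y := by
  rw [Fin.sum_univ_eq_sum_range fun i => if i < k then x else y]
  rw [← Finset.sum_range_add_sum_Ico _ hk]
  rw [Finset.sum_congr rfl fun i hi => if_pos (Finset.mem_range.mp hi),
    Finset.sum_congr (s₁ := Finset.Ico k n) rfl fun i hi =>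
      if_neg (not_lt.mpr (Finset.mem_Ico.mp hi).1)]
  simp [Nat.cast_sub hk]

/-- Some codebook guarantees nearly `a` before round `k` and nearly `c` afterwards, because a random
codebook does so on average. -/
theorem Guarantees.exists_protocol [Nonempty B] (H : Guarantees pS pUS pAU pay 𝒞 V a h) {K : ℝ}
    (hK0 : 0 ≤ K) (hK : ∀ a b s, |pay a b s| ≤ K) (hV : ∀ u y, 0 ≤ V u y)
    (hV1 : ∀ u, ∑ y, V u y = 1)
    (hVp : ∀ y, ∑ u, lawU pS pUS u * V u y = lawSA pS pUS pAU y) {c : ℝ}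
    (hc : c ≤ ∑ u, lawU pS pUS u * h u) {C : ℝ}
    (hC1 : chanInfoSq (lawU pS pUS) pS (backChan pS pUS) ≤ C)
    (hC2 : chanInfoSq (lawU pS pUS) (lawSA pS pUS pAU) (chanSA pS pUS pAU) ≤ C)
    (hC3 : chanInfoSq (lawU pS pUS) (lawSA pS pUS pAU) V ≤ C) (hn : 0 < n) (hM : 0 < M)
    {k : ℕ} (hk : k ≤ n) {R δ : ℝ} (hδ : 0 < δ) (hMR : (2 : ℝ) ^ (n * R) ≤ 2 * M)
    (hR1 : infoUS pS pUS pAU ≤ R - 2 * δ)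
    (hR2 : k * infoUSA pS pUS pAU + (n - k) * chanInfo (lawU pS pUS) (lawSA pS pUS pAU) V ≤
      n * (R - 2 * δ)) :
    ∃ σ : Protocol S A B n M, ∀ β ∈ 𝒞 n,
      c + k / n * (a - c) - 2 * K * (√(2 * (2 : ℝ) ^ (-δ * n)) + 2 * (C / (n * δ ^ 2))) ≤
        avgPayoff pay pS σ β := by
  have hn' : (0 : ℝ) < n := by exact_mod_cast hn
  have hM' : (0 : ℝ) < M := by exact_mod_cast hM
  set ε := √(2 * (2 : ℝ) ^ (-δ * n)) + 2 * (C / (n * δ ^ 2)) with hε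
  have hr := lawU_nonneg pS pUS
  have hr1 := sum_lawU pS pUS
  set μ : (Fin M → Fin n → U) → ℝ := fun c => ∏ m, ∏ i, lawU pS pUS (c m i) with hμ
  have hμ0 : ∀ c, 0 ≤ μ c := fun c =>
    Finset.prod_nonneg fun m _ => Finset.prod_nonneg fun i _ => hr _
  have hμ1 : ∑ c, μ c = 1 :=
    sum_prod_eq_one (ν := fun _ (x : Fin n → U) => ∏ i, lawU pS pUS (x i))
      fun _ => sum_prod_eq_one fun _ => hr1
  set D₁ : (Fin M → Fin n → U) → ℝ := fun c =>
    ∑ s : Fin n → S, |(∑ m, ∏ i, backChan pS pUS (c m i) (s i)) / M - ∏ i, pS (s i)| with hD₁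
  set D₂ : (Fin M → Fin n → U) → ℝ := fun c => ∑ y : Fin n → S × A, |(∑ m, ∏ j : Fin n,
    (if (j : ℕ) < k then chanSA pS pUS pAU else V) (c m j) (y j)) / M -
      ∏ j, lawSA pS pUS pAU (y j)| with hD₂
  have hE₁ : ∑ c, μ c * D₁ c ≤ ε :=
    softCovering (κ := Unit) hr hr1 (V := fun _ => backChan pS pUS)
      (fun _ => backChan_nonneg _ _) (fun _ => sum_backChan _ _)
      (fun _ => sum_lawU_mul_backChan _ _) (fun _ => hC1) hn (fun _ => ()) hδ
      (by
        rw [← infoUS_eq pS pUS pAU]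
        simpa using mul_le_mul_of_nonneg_left hR1 hn'.le) hM hMR
  have hE₂ : ∑ c, μ c * D₂ c ≤ ε := by
    refine softCovering (κ := Fin n) hr hr1
      (V := fun j => if (j : ℕ) < k then chanSA pS pUS pAU else V)
      (fun j => ?_) (fun j => ?_) (fun j => ?_) (fun j => ?_) hn (fun j => j) hδ ?_ hM hMR
    · split_ifs; exacts [chanSA_nonneg _ _ _, hV]
    · split_ifs; exacts [sum_chanSA _ _ _, hV1]
    · split_ifs; exacts [sum_lawU_mul_chanSA _ _ _, hVp]
    · split_ifs; exacts [hC2, hC3]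
    · refine le_trans (le_of_eq ?_) hR2
      rw [← sum_ite_lt_const hk, infoUSA_eq]
      refine Finset.sum_congr rfl fun i _ => ?_
      split_ifs <;> rfl
  have hEh : ∀ i : Fin n, ∑ c, μ c * ((∑ m, h (c m i)) / M) = ∑ u, lawU pS pUS u * h u := by
    intro i
    simp only [← mul_div_assoc]
    rw [← Finset.sum_div]
    simp only [Finset.mul_sum]
    rw [Finset.sum_comm]
    have h1 : ∀ m : Fin M, ∑ c, μ c * h (c m i) = ∑ u, lawU pS pUS u * h u := fun m => by
      rw [← sum_prod_apply (ν := fun _ => lawU pS pUS) (fun _ => hr1) i]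
      exact sum_prod_apply (ν := fun _ (x : Fin n → U) => ∏ i, lawU pS pUS (x i))
        (fun _ => sum_prod_eq_one fun _ => hr1) m fun x => h (x i)
    simp only [h1, Finset.sum_const, Finset.card_univ, Fintype.card_fin, nsmul_eq_mul]
    field_simp
  obtain ⟨code, hcode⟩ := exists_sum_mul_le hμ0 hμ1 fun c =>
    (∑ i : Fin n, if (i : ℕ) < k then a - K * D₂ c else (∑ m, h (c m i)) / M) / n - K * D₁ c
  refine ⟨codeProtocol pS pUS pAU B hM code, fun β hβ =>
    le_trans (le_trans ?_ hcode) (H.le_avgPayoff hK hn hM k code β hβ)⟩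
  have hround : ∀ i : Fin n, (if (i : ℕ) < k then a - K * ε else c) ≤
      ∑ c, μ c * (if (i : ℕ) < k then a - K * D₂ c else (∑ m, h (c m i)) / M) := by
    intro i
    split_ifs
    · have : ∑ c, μ c * (a - K * D₂ c) = a - K * ∑ c, μ c * D₂ c := by
        simp only [mul_sub, Finset.sum_sub_distrib, ← Finset.sum_mul, hμ1, one_mul, Finset.mul_sum]
        congr 1
        exact Finset.sum_congr rfl fun c _ => by ring
      rw [this]
      gcongr
    · rw [hEh]
      exact hc
  have hexp : ∑ c, μ c * ((∑ i : Fin n, if (i : ℕ) < k then a - K * D₂ c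
        else (∑ m, h (c m i)) / M) / n - K * D₁ c) =
      (∑ i : Fin n, ∑ c, μ c * (if (i : ℕ) < k then a - K * D₂ c
        else (∑ m, h (c m i)) / M)) / n - K * ∑ c, μ c * D₁ c := by
    rw [Finset.sum_comm, Finset.sum_div, Finset.mul_sum, ← Finset.sum_sub_distrib]
    refine Finset.sum_congr rfl fun c _ => ?_
    rw [← Finset.mul_sum]
    ring
  rw [hexp]
  calc c + k / n * (a - c) - 2 * K * ε ≤ (k * (a - K * ε) + (n - k) * c) / n - K * ε := by
        have hε0 : 0 ≤ K * ε := by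
          refine mul_nonneg hK0 (le_trans ?_ hE₁)
          exact Finset.sum_nonneg fun c _ => mul_nonneg (hμ0 c)
            (Finset.sum_nonneg fun s _ => abs_nonneg _)
        have hkn : (k : ℝ) / n ≤ 1 := by
          rw [div_le_one hn']; exact_mod_cast hk
        have e : ((k : ℝ) * (a - K * ε) + (n - k) * c) / n =
            c + k / n * (a - c) - k / n * (K * ε) := by
          field_simp
          ring
        rw [e]
        nlinarith
    _ = (∑ i : Fin n, if (i : ℕ) < k then a - K * ε else c) / n - K * ε := by
        rw [sum_ite_lt_const hk]
    _ ≤ _ := by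
        gcongr with i
        exact hround i

/-- The asymptotic form: the first `θ n` rounds are worth `a` and the other ones are worth `c`, if
the rate suffices to cover the states together with the first `θ n` actions. -/
theorem Guarantees.eventually_exists_protocol [Nonempty B]
    (H : Guarantees pS pUS pAU pay 𝒞 V a h) (hV : ∀ u y, 0 ≤ V u y)
    (hV1 : ∀ u, ∑ y, V u y = 1)
    (hVp : ∀ y, ∑ u, lawU pS pUS u * V u y = lawSA pS pUS pAU y) {c : ℝ}
    (hc : c ≤ ∑ u, lawU pS pUS u * h u) {θ P R : ℝ} (hθ0 : 0 ≤ θ) (hθ1 : θ ≤ 1)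
    (hP : P < c + θ * (a - c)) (hR1 : infoUS pS pUS pAU < R)
    (hI : chanInfo (lawU pS pUS) (lawSA pS pUS pAU) V ≤ infoUSA pS pUS pAU)
    (hR2 : chanInfo (lawU pS pUS) (lawSA pS pUS pAU) V +
      θ * (infoUSA pS pUS pAU - chanInfo (lawU pS pUS) (lawSA pS pUS pAU) V) < R) :
    ∀ᶠ n : ℕ in atTop, ∃ M : ℕ, (M : ℝ) ≤ 2 ^ ((n : ℝ) * R) ∧ ∃ σ : Protocol S A B n M,
      ∀ β ∈ 𝒞 n, P ≤ avgPayoff pay pS σ β := by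
  obtain ⟨K, hK0, hK⟩ : ∃ K : ℝ, 0 ≤ K ∧ ∀ a b s, |pay a b s| ≤ K := by
    refine ⟨∑ a, ∑ b, ∑ s, |pay a b s|, by positivity, fun a b s => ?_⟩
    calc |pay a b s| ≤ ∑ s, |pay a b s| :=
          Finset.single_le_sum (f := fun s => |pay a b s|) (fun _ _ => abs_nonneg _)
            (Finset.mem_univ s)
      _ ≤ ∑ b, ∑ s, |pay a b s| :=
          Finset.single_le_sum (f := fun b => ∑ s, |pay a b s|) (fun _ _ => by positivity)
            (Finset.mem_univ b)
      _ ≤ _ :=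
          Finset.single_le_sum (f := fun a => ∑ b, ∑ s, |pay a b s|) (fun _ _ => by positivity)
            (Finset.mem_univ a)
  set I' := chanInfo (lawU pS pUS) (lawSA pS pUS pAU) V with hI'
  obtain ⟨δ, hδ, hδ1, hδ2⟩ : ∃ δ > 0, infoUS pS pUS pAU ≤ R - 2 * δ ∧
      I' + θ * (infoUSA pS pUS pAU - I') ≤ R - 2 * δ := by
    refine ⟨min (R - infoUS pS pUS pAU) (R - (I' + θ * (infoUSA pS pUS pAU - I'))) / 2,
      half_pos (lt_min (by linarith) (by linarith)), ?_, ?_⟩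
    · linarith [min_le_left (R - infoUS pS pUS pAU) (R - (I' + θ * (infoUSA pS pUS pAU - I')))]
    · linarith [min_le_right (R - infoUS pS pUS pAU) (R - (I' + θ * (infoUSA pS pUS pAU - I')))]
  have hRpos : 0 < R := (infoUS_nonneg pS pUS pAU).trans_lt hR1
  set C := max (chanInfoSq (lawU pS pUS) pS (backChan pS pUS))
    (max (chanInfoSq (lawU pS pUS) (lawSA pS pUS pAU) (chanSA pS pUS pAU))
      (chanInfoSq (lawU pS pUS) (lawSA pS pUS pAU) V)) with hC
  have hlim : Tendsto (fun n : ℕ => c + (⌊θ * n⌋₊ : ℝ) / n * (a - c) -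
      2 * K * (√(2 * (2 : ℝ) ^ (-δ * n)) + 2 * (C / (n * δ ^ 2)))) atTop
      (nhds (c + θ * (a - c) - 2 * K * (√(2 * 0) + 2 * 0))) := by
    have h1 : Tendsto (fun n : ℕ => (⌊θ * n⌋₊ : ℝ) / n) atTop (nhds θ) :=
      (tendsto_nat_floor_mul_div_atTop hθ0).comp tendsto_natCast_atTop_atTop
    have h2 : Tendsto (fun n : ℕ => (2 : ℝ) ^ (-δ * n)) atTop (nhds 0) := by
      have : Tendsto (fun n : ℕ => ((2 : ℝ) ^ (-δ)) ^ n) atTop (nhds 0) :=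
        tendsto_pow_atTop_nhds_zero_of_lt_one (by positivity)
          (Real.rpow_lt_one_of_one_lt_of_neg one_lt_two (by linarith))
      refine this.congr fun n => ?_
      rw [Real.rpow_mul two_pos.le, Real.rpow_natCast]
    have h3 : Tendsto (fun n : ℕ => C / (n * δ ^ 2)) atTop (nhds 0) :=
      tendsto_const_nhds.div_atTop
        (tendsto_natCast_atTop_atTop.atTop_mul_const (by positivity))
    exact (tendsto_const_nhds.add (h1.mul_const _)).sub
      ((((h2.const_mul 2).sqrt).add (h3.const_mul 2)).const_mul _)
  have hlim' := hlim.eventually_const_le (u := P) (by simpa using hP)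
  filter_upwards [hlim', eventually_gt_atTop 0] with n hPn hn
  have hn' : (0 : ℝ) < n := by exact_mod_cast hn
  have h1 : (1 : ℝ) ≤ 2 ^ ((n : ℝ) * R) := Real.one_le_rpow one_le_two (by positivity)
  have hM : 0 < ⌊(2 : ℝ) ^ ((n : ℝ) * R)⌋₊ := Nat.floor_pos.mpr h1
  refine ⟨⌊(2 : ℝ) ^ ((n : ℝ) * R)⌋₊, Nat.floor_le (by positivity), ?_⟩
  have hMR : (2 : ℝ) ^ ((n : ℝ) * R) ≤ 2 * ⌊(2 : ℝ) ^ ((n : ℝ) * R)⌋₊ := by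
    have h2 := Nat.lt_floor_add_one ((2 : ℝ) ^ ((n : ℝ) * R))
    have h3 : (1 : ℝ) ≤ ⌊(2 : ℝ) ^ ((n : ℝ) * R)⌋₊ := by exact_mod_cast hM
    linarith
  have hfl : (⌊θ * n⌋₊ : ℝ) ≤ θ * n := Nat.floor_le (by positivity)
  have hk : ⌊θ * n⌋₊ ≤ n := by
    have : (⌊θ * n⌋₊ : ℝ) ≤ n := hfl.trans (mul_le_of_le_one_left hn'.le hθ1)
    exact_mod_cast this
  obtain ⟨σ, hσ⟩ := H.exists_protocol hK0 hK hV hV1 hVp hc (C := C) (le_max_left _ _)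
    ((le_max_left _ _).trans (le_max_right _ _)) ((le_max_right _ _).trans (le_max_right _ _)) hn
    hM hk hδ hMR hδ1 (by
      have : (⌊θ * n⌋₊ : ℝ) * (infoUSA pS pUS pAU - I') ≤
          θ * n * (infoUSA pS pUS pAU - I') :=
        mul_le_mul_of_nonneg_right hfl (by linarith)
      have h5 := mul_le_mul_of_nonneg_left hδ2 hn'.le
      rw [← hI']
      linarith)
  exact ⟨σ, fun β hβ => hPn.trans (hσ β hβ)⟩

end Protocols

/-! ### The two kinds of opponent -/

section Opponents

variable {S A B U : Type*} [Fintype S] [Fintype A] [Fintype B] [Fintype U] [Nonempty B]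
variable (pS : Distr S) (pUS : Chan S U) (pAU : Chan U A) (pay : A → B → S → ℝ)

theorem guarantees_blind : Guarantees pS pUS pAU pay
    (fun n => Set.range fun β : BlindStrategy S A B n => β.toInformed)
    (fun _ => lawSA pS pUS pAU) (minPay pay pS pUS pAU) (valU pS pUS pAU pay) where
  redraw := by
    rintro n _ ⟨β, rfl⟩ k i hi u
    refine sum_prod_congr (fun j => sum_chanSA _ _ _ _) (fun j => ?_) _ fun j => ?_
    · split_ifs; exacts [sum_chanSA _ _ _ _, sum_lawSA _ _ _]
    · by_cases hj : (j : ℕ) < k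
      · left; rw [if_pos hj]
      · right
        intro y v
        have hij : i < j := by rw [Fin.lt_def]; omega
        have h1 := (isCausal_blind β).sum_congr i (y := Function.update y j v) (y' := y)
          (fun l hl => Function.update_of_ne (hl.trans hij).ne _ _)
          (fun b => pay (y i).2 b (y i).1)
        unfold condPay
        rw [Function.update_of_ne hij.ne]
        exact h1
  iid := by
    rintro n _ ⟨β, rfl⟩ i
    exact (isCausal_blind β).le_sum (fun _ => lawSA_nonneg _ _ _) (fun _ => sum_lawSA _ _ _) i
      (fun y b => pay y.2 b y.1) (minPay_le pS pUS pAU pay)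
  codeword := by
    rintro n _ ⟨β, rfl⟩ i u
    exact (isCausal_blind β).le_sum (fun _ => chanSA_nonneg _ _ _ _) (fun _ => sum_chanSA _ _ _ _) i
      (fun y b => pay y.2 b y.1) (valU_le pS pUS pAU pay (u i))

theorem guarantees_informed : Guarantees pS pUS pAU pay (fun _ => Set.univ)
    (chanSARedrawn pS pUS pAU) (minPayS pay pS pUS pAU)
    (fun u => ∑ s, backChan pS pUS u s * valSU pAU pay u s) where
  redraw := by
    intro n β _ k i hi u
    have e : ∀ y : Fin n → S × A, (∏ j : Fin n, (if (j : ℕ) < k then chanSA pS pUS pAU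
        else chanSARedrawn pS pUS pAU) (u j) (y j)) =
        ∏ j : Fin n, backChan pS pUS (u j) (y j).1 *
          (if (j : ℕ) < k then pAU (u j) (y j).2 else actLaw pUS pAU (y j).1 (y j).2) := fun y =>
      Finset.prod_congr rfl fun j _ => by split_ifs <;> rfl
    simp only [e]
    refine (sum_prod_pair (fun j => backChan pS pUS (u j)) (fun j _ => pAU (u j)) _).trans
      (Eq.trans ?_ (sum_prod_pair (fun j => backChan pS pUS (u j))
        (fun j s a => if (j : ℕ) < k then pAU (u j) a else actLaw pUS pAU s a) _).symm)
    refine Finset.sum_congr rfl fun s _ => ?_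
    congr 1
    refine sum_prod_congr (ν := fun j => pAU (u j))
      (ν' := fun j a => if (j : ℕ) < k then pAU (u j) a else actLaw pUS pAU (s j) a)
      (fun j => stdSimplex.sum_eq_one _) (fun j => ?_) _ fun j => ?_
    · split_ifs; exacts [stdSimplex.sum_eq_one _, sum_actLaw _ _ _]
    · by_cases hj : (j : ℕ) < k
      · left; simp only [if_pos hj]
      · right
        intro a v
        have hij : i < j := by rw [Fin.lt_def]; omega
        have h1 := (isCausal_informed β s).sum_congr i (y := Function.update a j v) (y' := a)
          (fun l hl => Function.update_of_ne (hl.trans hij).ne _ _) (fun b => pay (a i) b (s i))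
        simp only [condPay]
        rw [Function.update_of_ne hij.ne]
        exact h1
  iid := by
    intro n β _ i
    refine le_trans (minPayS_le pS pUS pAU pay) ?_
    rw [← sum_prod_apply (ν := fun _ => pS) (fun _ => stdSimplex.sum_eq_one _) i]
    refine le_trans ?_ (sum_prod_pair (fun _ => pS) (fun _ => actLaw pUS pAU) _).ge
    refine Finset.sum_le_sum fun s _ => mul_le_mul_of_nonneg_left ?_
      (Finset.prod_nonneg fun j _ => stdSimplex.zero_le _ _)
    exact (isCausal_informed β s).le_sum (fun j => actLaw_nonneg _ _ _) (fun j => sum_actLaw _ _ _)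
      i (fun a b => pay a b (s i)) (valS_le pUS pAU pay (s i))
  codeword := by
    intro n β _ i u
    rw [← sum_prod_apply (ν := fun j => backChan pS pUS (u j)) (fun j => sum_backChan _ _ _) i]
    refine le_trans ?_ (sum_prod_pair (fun j => backChan pS pUS (u j))
      (fun j _ => pAU (u j)) _).ge
    refine Finset.sum_le_sum fun s _ => mul_le_mul_of_nonneg_left ?_
      (Finset.prod_nonneg fun j _ => backChan_nonneg _ _ _ _)
    exact (isCausal_informed β s).le_sum (fun j => stdSimplex.zero_le _)
      (fun j => stdSimplex.sum_eq_one _) i (fun a b => pay a b (s i)) (valSU_le pAU pay (u i) (s i))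

/-- The choice of the fraction `θ` of rounds in which Player B gains nothing from the past, where
`I` is the information he gains per round: `0` if the later value `c` already exceeds `P`, and
otherwise slightly more than the weight at which the values `a` and `c` average to `P`. -/
theorem exists_fraction {P a c I R : ℝ} (hPa : P < a) (hR : 0 < R)
    (h : c ≤ P → I * ((P - c) / (a - c)) < R) :
    ∃ θ, 0 ≤ θ ∧ θ ≤ 1 ∧ P < c + θ * (a - c) ∧ θ * I < R := by
  rcases lt_or_ge P c with hc | hc
  · exact ⟨0, le_rfl, zero_le_one, by simpa using hc, by simpa using hR⟩
  have hac : 0 < a - c := by linarith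
  set f := (P - c) / (a - c) with hf
  have hf0 : 0 ≤ f := div_nonneg (by linarith) hac.le
  have hf1 : f < 1 := (div_lt_one hac).mpr (by linarith)
  have hlim : Tendsto (fun θ : ℝ => θ * I) (nhdsWithin f (Set.Ioi f)) (nhds (f * I)) :=
    ((continuous_id.mul continuous_const).tendsto f).mono_left nhdsWithin_le_nhds
  have hev := (hlim.eventually_lt_const (by rw [mul_comm]; exact h hc)).and
    (Ioo_mem_nhdsGT hf1)
  obtain ⟨θ, h1, h2, h3⟩ := hev.exists
  refine ⟨θ, hf0.trans h2.le, h3.le, ?_, h1⟩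
  have : f * (a - c) = P - c := div_mul_cancel₀ _ hac.ne'
  nlinarith

theorem achievableBlind_of_lt {P R : ℝ} (hP : P < minPay pay pS pUS pAU)
    (hR1 : infoUS pS pUS pAU < R)
    (hR2 : infoUSA pS pUS pAU * ((P - minPayU pay pS pUS pAU) /
      (minPay pay pS pUS pAU - minPayU pay pS pUS pAU)) < R) :
    AchievableBlind pay pS P R := by
  obtain ⟨θ, h0, h1, hθP, hθR⟩ := exists_fraction hP
    ((infoUS_nonneg pS pUS pAU).trans_lt hR1) fun _ => hR2
  have h := (guarantees_blind pS pUS pAU pay).eventually_exists_protocol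
    (fun _ => lawSA_nonneg _ _ _) (fun _ => sum_lawSA _ _ _)
    (fun y => by rw [← Finset.sum_mul, sum_lawU, one_mul]) (minPayU_le pS pUS pAU pay) h0 h1 hθP hR1
    (by rw [chanInfo_const]; exact infoUSA_nonneg _ _ _)
    (by rw [chanInfo_const]; simpa using hθR)
  filter_upwards [h] with n ⟨M, hM, σ, hσ⟩
  exact ⟨M, hM, σ, fun β => hσ _ ⟨β, rfl⟩⟩

theorem achievableInformed_of_lt {P R : ℝ} (hP : P < minPayS pay pS pUS pAU)
    (hR : infoUS pS pUS pAU + infoUAgivenS pS pUS pAU *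
      max ((P - minPaySU pay pS pUS pAU) /
        (minPayS pay pS pUS pAU - minPaySU pay pS pUS pAU)) 0 < R) :
    AchievableInformed pay pS P R := by
  have hI := infoUAgivenS_nonneg pS pUS pAU
  have hR1 : infoUS pS pUS pAU < R :=
    (le_add_of_nonneg_right (mul_nonneg hI (le_max_right _ _))).trans_lt hR
  obtain ⟨θ, h0, h1, hθP, hθR⟩ := exists_fraction (I := infoUAgivenS pS pUS pAU) hP
    (sub_pos.mpr hR1) fun _ =>
      (mul_le_mul_of_nonneg_left (le_max_left _ _) hI).trans_lt (lt_sub_iff_add_lt'.mpr hR)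
  have h := (guarantees_informed pS pUS pAU pay).eventually_exists_protocol
    (chanSARedrawn_nonneg _ _ _) (sum_chanSARedrawn _ _ _) (sum_lawU_mul_chanSARedrawn _ _ _)
    (minPaySU_le pS pUS pAU pay) h0 h1 hθP hR1
    (by rw [chanInfo_chanSARedrawn, infoUSA_eq_add]; linarith)
    (by rw [chanInfo_chanSARedrawn, infoUSA_eq_add]; linarith)
  filter_upwards [h] with n ⟨M, hM, σ, hσ⟩
  exact ⟨M, hM, σ, fun β => hσ β (Set.mem_univ β)⟩

end Opponents

end BayesGame

theorem theorem1 {S A B : Type*} [Fintype S] [Fintype A] [Fintype B] [Nonempty B]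
    (pS : BayesGame.Distr S) (pay : A → B → S → ℝ) (P R : ℝ) :
    ((∃ (U : Type*) (_ : Fintype U) (pUS : BayesGame.Chan S U) (pAU : BayesGame.Chan U A),
        BayesGame.minPay pay pS pUS pAU > P ∧
        R > BayesGame.infoUS pS pUS pAU ∧
        R > BayesGame.infoUSA pS pUS pAU *
          ((P - BayesGame.minPayU pay pS pUS pAU) /
            (BayesGame.minPay pay pS pUS pAU - BayesGame.minPayU pay pS pUS pAU))) →
      BayesGame.AchievableBlind pay pS P R) ∧
    ((∃ (U : Type*) (_ : Fintype U) (pUS : BayesGame.Chan S U) (pAU : BayesGame.Chan U A),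
        BayesGame.minPayS pay pS pUS pAU > P ∧
        R > BayesGame.infoUS pS pUS pAU + BayesGame.infoUAgivenS pS pUS pAU *
          max ((P - BayesGame.minPaySU pay pS pUS pAU) /
            (BayesGame.minPayS pay pS pUS pAU - BayesGame.minPaySU pay pS pUS pAU)) 0) →
      BayesGame.AchievableInformed pay pS P R) := by
  constructor
  · rintro ⟨U, _, pUS, pAU, h1, h2, h3⟩
    exact BayesGame.achievableBlind_of_lt pS pUS pAU pay h1 h2 h3
  · rintro ⟨U, _, pUS, pAU, h1, h2⟩
    exact BayesGame.achievableInformed_of_lt pS pUS pAU pay h1 h2
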